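/- **Setting.** A sender transmits private messages, one to each of $N\ge 2$ receivers, by $n$ uses of a binary broadcast channel. At use $t$ a vector $x_t\in\{0,1\}^N$ is uniformly random (independently over $t$), its bit $x_{i,t}$ is given to receiver $i$, and the bit $u_{i,t}$ sent to receiver $i$ arrives as $u_{i,t}\oplus s_t$, with the common channel state $s_t=\sum_i x_{i,t}\bmod 2$. The receivers have classical broadcast communication and shared entanglement, and use a protocol with $x_{1}^n,\dots,x_{N}^n$ (where $x_i^n=(x_{i,t})_{t\le n}$) as inputs, from which receiver $i$ obtains a word $\gamma_i^n$ that helps it to decode. A rate tuple $(R_1,\dots,R_N)$ is achievable with the protocol if there are codes for $n=1,2,\dots$, with message sets $\mathbf M_{i,n}$ and disjoint decoding sets depending on $\gamma_i^n$, such that $\liminf_n\frac1n\log_2|\mathbf M_{i,n}|\ge R_i$ for all $i$, and the average probability that some receiver decodes wrongly tends to $0$. The phase-GHZ state is $|GHZ\rangle_p=2^{-(N-1)/2}\sum_{r\in\{0,1\}^N,\ \sum_i r_i\equiv 0\,(2)}|r\rangle$. A *summation protocol based on verified phase-GHZ states* works as follows. A source distributes copies of $|GHZ\rangle_p$ ($i$-th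 qubits to receiver $i$) in one transmission. By a uniformly random, public allocation, which the receivers announce, every receiver gets the same number of test copies, and one key copy is left. The receivers measure the qubits of the test copies one by one in bases prescribed by the protocol, and broadcast the outcomes; if these violate the acceptance condition prescribed by the protocol for the test copies of any receiver, the protocol is aborted. Otherwise receiver $i$ measures its qubit of the key copy in the computational basis, with outcome $R_i$, and broadcasts $x_{i,t}+R_i$ for all $t\le n$; the modulo-2 sum over $i$ is taken as the channel state $s_t$. **Theorem.** There are such protocols, one for every number $N\ge2$ of receivers and every security parameter $m\ge1$ (for all $n$ at once), and $\varepsilon(m)\to0$ as $m\to\infty$, such that, with constants independent of $N,m,n$: 1. the number of messages sent in a run (the source's transmission and the receivers' broadcasts, a message being one transmission of any length) is of order $N$, between two positive constant multiples of $N$; 2. the number of phase-GHZ states used is of order $N^2m$, between two positive constant multiples of $N^2m$; 3. the rate tuple $1^N=(1,\dots,1)$ is achievable with the protocol, and if all receivers are honest, then each of them obtains all channel states with certainty; 4. (unconditional security) for every coalition $Z$ of at most $N-2$ receivers that performs any quantum operations on its shares of the phase-GHZ states, announces any outcomes, and has unlimited computing power, and for every receiver $i\notin Z$, the bit $R_i$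 is uniform and $I(R_i;Y_Z)=0$. Here $Y_Z$ is everything that $Z$ learns: the allocation, all announced test outcomes, the bits $x_{j,t}+R_j$ of the receivers $j\notin Z$ if they are broadcast, its own $x_{j,t}$, the channel states, and the results of its measurements; 5. (verification) if the source is not trusted and distributes an arbitrary state, then (a) with honest receivers, the probability that the protocol is not aborted but yields a wrong channel state is at most $\varepsilon(m)$; (b) for every coalition $Z$ as in 4 that controls the source and holds an arbitrary finite-dimensional quantum system correlated with the qubits of the others, and every $i\notin Z$, the joint distribution of $R_i$ and $Y_Z$, restricted to the event that the protocol is not aborted, is within statistical distance $\varepsilon(m)$ of that of a uniform bit and an independent $Y_Z$. -/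

import Mathlib

open Filter Topology
open scoped ComplexOrder

noncomputable section

/-- Bits, with addition modulo two. -/
abbrev Bit := ZMod 2

/-! ### The causal broadcast channel, codes and achievable rates -/

/-- The channel state `Φ(x_t^N) = ∑ i, x_{i,t} mod 2` at each transmission `t`. -/
def channelState {N n : ℕ} (x : Fin N → Fin n → Bit) : Fin n → Bit :=
  fun t => ∑ i, x i t

/-- The binary channel with state `s`: the identity if `s = 0`, the bit flip if `s = 1`. -/
def stateChannel (s u : Bit) : Bit := if s = 0 then u else u + 1

/-- The word that a receiver gets when `u` is sent in `n` channel uses with states `s`. -/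
def channelOutput {n : ℕ} (s u : Fin n → Bit) : Fin n → Bit :=
  fun t => stateChannel (s t) (u t)

/-- A broadcast code of block-length `n` for `N` receivers, with private message sets
`Fin (size i)`, whose decoding sets depend on the coordination word in `Γ^n`. -/
structure BroadcastCode (N n : ℕ) (Γ : Type) where
  size : Fin N → ℕ
  size_pos : ∀ i, 0 < size i
  encode : (∀ i, Fin (size i)) → Fin N → Fin n → Bit
  decodeSet : ∀ i, (Fin n → Γ) → Fin (size i) → Set (Fin n → Bit)
  decodeSet_disjoint : ∀ i γ j k, j ≠ k → Disjoint (decodeSet i γ j) (decodeSet i γ k)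

/-- A (not yet normalised) coordinator: `q x γ` is the probability that the receivers obtain the
coordination words `γ` when they put in their shares `x` of the state information. -/
abbrev Coordinator (N n : ℕ) (Γ : Type) :=
  (Fin N → Fin n → Bit) → (Fin N → Fin n → Γ) → ℝ

/-- `q` is a classical channel, i.e. every row is a probability distribution. -/
def IsChannel {N n : ℕ} {Γ : Type} [Fintype Γ] (q : Coordinator N n Γ) : Prop :=
  ∀ x, (∀ γ, 0 ≤ q x γ) ∧ ∑ γ, q x γ = 1

open Classical in
/-- Average probability that all receivers decode their messages correctly, for uniform messages
and uniform state information. -/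
def successProb {N n : ℕ} {Γ : Type} [Fintype Γ] (q : Coordinator N n Γ)
    (C : BroadcastCode N n Γ) : ℝ :=
  1 / ((∏ i, (C.size i : ℝ)) * 2 ^ (N * n)) *
    ∑ msg : (∀ i, Fin (C.size i)), ∑ x : Fin N → Fin n → Bit, ∑ γ : Fin N → Fin n → Γ,
      q x γ * ∏ i, if channelOutput (channelState x) (C.encode msg i) ∈ C.decodeSet i (γ i) (msg i)
        then (1 : ℝ) else 0

/-- The rate tuple `R` is achievable when the receivers coordinate through `q n` at
block-length `n`. -/
def Achievable {N : ℕ} {Γ : Type} [Fintype Γ] (q : ∀ n, Coordinator N n Γ)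
    (R : Fin N → ℝ) : Prop :=
  (∀ n, IsChannel (q n)) ∧
  ∃ C : ∀ n, BroadcastCode N n Γ,
    (∀ i, (R i : EReal) ≤
      liminf (fun n : ℕ => ((1 / (n : ℝ) * Real.logb 2 ((C n).size i) : ℝ) : EReal)) atTop) ∧
    Tendsto (fun n => 1 - successProb (q n) (C n)) atTop (𝓝 0)

/-! ### Quantum states and measurements -/

/-- Density matrices. -/
def IsDensity {α : Type} [Fintype α] (ρ : Matrix α α ℂ) : Prop :=
  ρ.PosSemidef ∧ ρ.trace = 1

/-- Amplitudes of the `N`-qubit phase-GHZ state: the uniform superposition of all bit strings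
with sum zero. -/
def phaseGHZ (N : ℕ) (r : Fin N → Bit) : ℂ :=
  if ∑ i, r i = 0 then (((Real.sqrt (2 ^ (N - 1)))⁻¹ : ℝ) : ℂ) else 0

/-- Amplitudes of a tensor product of phase-GHZ states, one for each `c : κ`. Receiver `i` holds
the qubits `(i, c)`. -/
def ghzCopies (N : ℕ) (κ : Type) [Fintype κ] (a : Fin N → κ → Bit) : ℂ :=
  ∏ c, phaseGHZ N fun i => a i c

/-- The density matrix of these copies. -/
def ghzSource (N : ℕ) (κ : Type) [Fintype κ] :
    Matrix (Fin N → κ → Bit) (Fin N → κ → Bit) ℂ :=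
  Matrix.vecMulVec (ghzCopies N κ) (star (ghzCopies N κ))

/-- Receivers outside, respectively inside, a coalition. -/
abbrev Honest {N : ℕ} (Z : Finset (Fin N)) := {i : Fin N // i ∉ Z}
abbrev Colluding {N : ℕ} (Z : Finset (Fin N)) := {i : Fin N // i ∈ Z}

/-- Put together data of the honest and of the colluding receivers. -/
def joinData {N : ℕ} (Z : Finset (Fin N)) {A : Type} (a : Honest Z → A) (e : Colluding Z → A) :
    Fin N → A :=
  fun i => if h : i ∈ Z then e ⟨i, h⟩ else a ⟨i, h⟩

/-- The same state, with the qubits of the coalition `Z` split off as a second tensor factor. -/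
def ghzSplit {N : ℕ} (Z : Finset (Fin N)) (κ : Type) [Fintype κ] :
    Matrix ((Honest Z → κ → Bit) × (Colluding Z → κ → Bit))
      ((Honest Z → κ → Bit) × (Colluding Z → κ → Bit)) ℂ :=
  (ghzSource N κ).submatrix (fun p => joinData Z p.1 p.2) (fun p => joinData Z p.1 p.2)

/-- The projection for outcomes `out` when every qubit `(i, c)` is measured in the orthonormal
basis formed by the columns of the unitary matrix `B i c`. -/
def outcomeProj {ι κ : Type} [Fintype ι] [Fintype κ]
    (B : ι → κ → Matrix.unitaryGroup Bit ℂ) (out : ι → κ → Bit) :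
    Matrix (ι → κ → Bit) (ι → κ → Bit) ℂ :=
  Matrix.of fun a b => ∏ i, ∏ c,
    (B i c : Matrix Bit Bit ℂ) (a i c) (out i c) *
      star ((B i c : Matrix Bit Bit ℂ) (b i c) (out i c))

/-! ### Summation protocols based on verified phase-GHZ states -/

/-- A multi-party summation protocol based on verified phase-GHZ states, run as follows.

* A source distributes `N * tests + 1` copies of the phase-GHZ state.
* The copies are allocated at random: every receiver gets `tests` copies for a validation, and one
  key copy is left over. The allocation is announced.
* Receiver `j` measures its qubit of the `k`-th test copy of receiver `v` in the basis
  `basis v k j`, and broadcasts all its outcomes.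
* Receiver `v` is content if the outcomes for its test copies lie in `accept v`. If one of them is
  not, the protocol is aborted.
* Receiver `i` measures its qubit of the key copy in the computational basis, with outcome `r i`,
  and broadcasts the masked bits `x i t + r i` for all `t`.
* Everybody takes the sums of the masked bits as the channel states. -/
structure GHZProtocol (N : ℕ) where
  tests : ℕ
  basis : Fin N → Fin tests → Fin N → Matrix.unitaryGroup Bit ℂ
  accept : Fin N → Set (Fin tests → Fin N → Bit)

namespace GHZProtocol

variable {N : ℕ} (P : GHZProtocol N)

/-- Test copies: `(v, k)` is the `k`-th test copy of receiver `v`. -/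
abbrev Test := Fin N × Fin P.tests

/-- Roles that a copy can have: `none` is the key copy. Since there are as many copies as roles,
this type also serves to index the copies. -/
abbrev Copy := Option P.Test

/-- An allocation assigns a role to every copy. -/
abbrev Allocation := Equiv.Perm P.Copy

/-- The basis in which receiver `j` measures a copy with a given role. -/
def roleBasis (j : Fin N) : P.Copy → Matrix.unitaryGroup Bit ℂ
  | none => 1
  | some (v, k) => P.basis v k j

/-- The validation succeeds on the announced outcomes. -/
def Passes (ann : Fin N → P.Test → Bit) : Prop :=
  ∀ v, (fun k j => ann j (v, k)) ∈ P.accept v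

/-- Number of phase-GHZ states used. -/
def entanglementCost : ℕ := Fintype.card P.Copy

/-- The messages that are sent in a run. -/
inductive Message (n : ℕ)
  /-- The transmission in which the source sends all the states. -/
  | frame
  /-- Receiver `v` announces its test copies. -/
  | selection (v : Fin N) (copies : Fin P.tests → P.Copy)
  /-- Receiver `j` announces its outcomes for the test copies. -/
  | outcomes (j : Fin N) (o : P.Test → Bit)
  /-- Receiver `j` announces its masked state information. -/
  | masked (j : Fin N) (s : Fin n → Bit)

open Classical in
/-- All messages of a run with allocation `π`, announced test outcomes `ann` and masked state
information `s`. -/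
def transcript {n : ℕ} (π : P.Allocation) (ann : Fin N → P.Test → Bit)
    (s : Fin N → Fin n → Bit) : List (P.Message n) :=
  [Message.frame] ++
    List.ofFn (fun v => Message.selection v fun k => π.symm (some (v, k))) ++
    List.ofFn (fun j => Message.outcomes j (ann j)) ++
    if P.Passes ann then List.ofFn (fun j => Message.masked j (s j)) else []

/-! #### All receivers honest -/

/-- Probability of the allocation `π` and the outcomes `out` (indexed by receiver and role) when
all receivers are honest and the source distributes the state `ρ`. -/
def honestProb (ρ : Matrix (Fin N → P.Copy → Bit) (Fin N → P.Copy → Bit) ℂ)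
    (π : P.Allocation) (out : Fin N → P.Copy → Bit) : ℝ :=
  1 / (Fintype.card P.Allocation : ℝ) *
    (ρ * outcomeProj (fun j c => P.roleBasis j (π c)) (fun j c => out j (π c))).trace.re

open Classical in
/-- What the receivers obtain at the end: the computed channel states, or `none` after an abort. -/
def output {n : ℕ} (out : Fin N → P.Copy → Bit) (x : Fin N → Fin n → Bit) :
    Fin n → Option Bit :=
  if P.Passes (fun j τ => out j (some τ)) then fun t => some (∑ j, (x j t + out j none))
  else fun _ => none

open Classical in
/-- The coordinator that the protocol implements with a source `ρ` and honest receivers. -/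
def coordinator (ρ : Matrix (Fin N → P.Copy → Bit) (Fin N → P.Copy → Bit) ℂ) (n : ℕ) :
    Coordinator N n (Option Bit) :=
  fun x γ => ∑ π : P.Allocation, ∑ out : Fin N → P.Copy → Bit,
    if ∀ i, γ i = P.output out x then P.honestProb ρ π out else 0

/-- With phase-GHZ states and honest receivers, each receiver obtains the channel states with
certainty. -/
def Reliable : Prop :=
  ∀ (n : ℕ) (x : Fin N → Fin n → Bit),
    P.coordinator (ghzSource N P.Copy) n x (fun _ t => some (channelState x t)) = 1

open Classical in
/-- Whatever state the source distributes to honest receivers, the probability that the protocol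
is not aborted and yet yields a wrong channel state is at most `ε`. -/
def VerifiesSum (ε : ℝ) : Prop :=
  ∀ ρ : Matrix (Fin N → P.Copy → Bit) (Fin N → P.Copy → Bit) ℂ, IsDensity ρ →
    ∀ (n : ℕ) (x : Fin N → Fin n → Bit),
      ∑ γ : Fin N → Fin n → Option Bit,
        (if ∃ i t s, γ i t = some s ∧ s ≠ channelState x t
          then P.coordinator ρ n x γ else 0) ≤ ε

/-! #### A coalition of dishonest receivers -/

/-- An arbitrary attack of a coalition `Z` that holds a quantum system with basis `E`. It knows
its own state information `xZ`, the channel states `φ`, and the allocation `π`. After it has seen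
the outcomes `o` that the honest receivers announce, it announces outcomes `c`. Then it sees the
masked state information of the honest receivers (`none` if the protocol was aborted), and
measures what is left of its system, with result `y`. Such two-step measurements are given by the
effects of their combined outcomes `(c, y)`, the effect `claim` of `c` being independent of what is
seen later. -/
structure Attack (n : ℕ) (Z : Finset (Fin N)) (E Y : Type) [Fintype E] [DecidableEq E]
    [Fintype Y] where
  effect : (xZ : Colluding Z → Fin n → Bit) → (φ : Fin n → Bit) → (π : P.Allocation) →
    (o : Honest Z → P.Test → Bit) → (c : Colluding Z → P.Test → Bit) →
    (s : Option (Honest Z → Fin n → Bit)) → (y : Y) → Matrix E E ℂ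
  claim : (xZ : Colluding Z → Fin n → Bit) → (φ : Fin n → Bit) → (π : P.Allocation) →
    (o : Honest Z → P.Test → Bit) → (c : Colluding Z → P.Test → Bit) → Matrix E E ℂ
  effect_posSemidef : ∀ xZ φ π o c s y, (effect xZ φ π o c s y).PosSemidef
  sum_effect : ∀ xZ φ π o c s, ∑ y, effect xZ φ π o c s y = claim xZ φ π o c
  sum_claim : ∀ xZ φ π o, ∑ c, claim xZ φ π o c = 1

/-- All that the coalition learns: the allocation, all announced outcomes, the masked state
information of the honest receivers, its own state information, the channel states, and the result
of its measurement. -/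
abbrev View (n : ℕ) (Z : Finset (Fin N)) (Y : Type) :=
  P.Allocation × (Fin N → P.Test → Bit) × Option (Honest Z → Fin n → Bit) ×
    (Colluding Z → Fin n → Bit) × (Fin n → Bit) × Y

variable {P} {n : ℕ} {Z : Finset (Fin N)} {E Y : Type} [Fintype E] [DecidableEq E] [Fintype Y]

/-- Announced outcomes of all receivers, if the coalition announces `c`. -/
def announced (out : Honest Z → P.Copy → Bit) (c : Colluding Z → P.Test → Bit) :
    Fin N → P.Test → Bit :=
  joinData Z (fun j τ => out j (some τ)) c

open Classical in
/-- Masked state information that the honest receivers announce. -/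
def maskedInfo (out : Honest Z → P.Copy → Bit) (c : Colluding Z → P.Test → Bit)
    (x : Fin N → Fin n → Bit) : Option (Honest Z → Fin n → Bit) :=
  if P.Passes (announced out c) then some (fun j t => x j t + out j none) else none

/-- Probability of a run under attack: uniform state information `x`, uniform allocation `π`,
outcomes `out` of the honest receivers, and announcement `c` and result `y` of the coalition, when
the source distributes the state `ρ` to the honest receivers and the coalition. -/
def attackProb (ρ : Matrix ((Honest Z → P.Copy → Bit) × E) ((Honest Z → P.Copy → Bit) × E) ℂ)
    (A : P.Attack n Z E Y) (x : Fin N → Fin n → Bit) (π : P.Allocation)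
    (out : Honest Z → P.Copy → Bit) (c : Colluding Z → P.Test → Bit) (y : Y) : ℝ :=
  1 / (2 ^ (N * n) * (Fintype.card P.Allocation : ℝ)) *
    (ρ * Matrix.kronecker
      (outcomeProj (fun (j : Honest Z) d => P.roleBasis j (π d)) (fun j d => out j (π d)))
      (A.effect (fun j : Colluding Z => x j) (channelState x) π (fun j τ => out j (some τ)) c
        (maskedInfo out c x) y)).trace.re

open Classical in
/-- Joint distribution of the mask `R_i` of an honest receiver and the view of the coalition. -/
def maskViewProb (ρ : Matrix ((Honest Z → P.Copy → Bit) × E) ((Honest Z → P.Copy → Bit) × E) ℂ)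
    (A : P.Attack n Z E Y) (i : Honest Z) (r : Bit) (v : P.View n Z Y) : ℝ :=
  ∑ x : Fin N → Fin n → Bit, ∑ π : P.Allocation, ∑ out : Honest Z → P.Copy → Bit,
    ∑ c : Colluding Z → P.Test → Bit, ∑ y : Y,
      if out i none = r ∧
          v = (π, announced out c, maskedInfo out c x, (fun j : Colluding Z => x j), channelState x, y)
        then attackProb ρ A x π out c y else 0

end GHZProtocol

/-- Shannon entropy, in bits, of a distribution on a finite set. -/
def shannonEntropy {α : Type} [Fintype α] (p : α → ℝ) : ℝ :=
  ∑ a, -(p a * Real.logb 2 (p a))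

/-- Mutual information, in bits, of a joint distribution on a product of finite sets. -/
def mutualInformation {α β : Type} [Fintype α] [Fintype β] (J : α → β → ℝ) : ℝ :=
  shannonEntropy (fun a => ∑ b, J a b) + shannonEntropy (fun b => ∑ a, J a b) -
    shannonEntropy (fun p : α × β => J p.1 p.2)

namespace GHZProtocol

variable {N : ℕ} (P : GHZProtocol N)

/-- Unconditional security: for every coalition `Z` of at most `N - 2` receivers, every attack of
it on its shares of the phase-GHZ states, and every honest receiver `i`, the mask `R_i` is uniform,
and `I(R_i; Y_Z) = 0` for the view `Y_Z` of the coalition. -/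
def UnconditionallySecure : Prop :=
  ∀ (n : ℕ) (Z : Finset (Fin N)), Z.card + 2 ≤ N →
    ∀ (Y : Type) [Fintype Y] (A : P.Attack n Z (Colluding Z → P.Copy → Bit) Y) (i : Honest Z),
      (∀ r, ∑ v, maskViewProb (ghzSplit Z P.Copy) A i r v = 1 / 2) ∧
      mutualInformation (maskViewProb (ghzSplit Z P.Copy) A i) = 0

open Classical in
/-- Verified security: even if the source is controlled by the coalition, so that an arbitrary
state of the qubits of the honest receivers and of an arbitrary system of the coalition is
distributed, the mask of an honest receiver, on the event that the validation succeeds, is within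
statistical distance `ε` of a uniform bit independent of the view of the coalition. -/
def VerifiesSecurity (ε : ℝ) : Prop :=
  ∀ (n : ℕ) (Z : Finset (Fin N)), Z.card + 2 ≤ N →
    ∀ (E Y : Type) [Fintype E] [DecidableEq E] [Fintype Y]
      (ρ : Matrix ((Honest Z → P.Copy → Bit) × E) ((Honest Z → P.Copy → Bit) × E) ℂ),
      IsDensity ρ → ∀ (A : P.Attack n Z E Y) (i : Honest Z),
        1 / 2 * ∑ v : P.View n Z Y, (if P.Passes v.2.1 then
          ∑ r, |maskViewProb ρ A i r v - 1 / 2 * ∑ r', maskViewProb ρ A i r' v| else 0) ≤ ε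

end GHZProtocol

end

noncomputable section

/-! ### Linear algebra of measurements -/

section Measurements

variable {ι κ : Type} [Fintype ι] [Fintype κ]

/-! The phase-GHZ state is fixed by the joint bit flip X_iX_j of any two qubits, and all its
computational outcomes have even sum. The protocol `verifiedSum` tests both facts: half of the test
copies are measured in the computational basis and must have even parity, the other half in the
Hadamard basis and must give equal outcomes, that is, eigenvalue 1 of every X_iX_j. With GHZ copies,
the amplitude of any outcome that fails a test or makes the key sum odd has a vanishing factor
(`verifiedSum_honestProb_eq_zero`). So the channel states are obtained with certainty, and the code
of all words has rate one.

Security with an honest source is an exact symmetry. A coalition of at most N-2 receivers leaves two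
honest ones, i and j. Flipping their key outcomes and their state information together (`flipRun`)
changes nothing that the coalition sees: masked bits and channel states are preserved. It preserves
probabilities because X_iX_j fixes the state, while R_i is flipped. Hence R_i is uniform and
independent of the view (`unconditionallySecure`, for every protocol of this type).

With an untrusted source, the random allocation makes the key copy exchangeable with the test copies
measured in the same basis, so a bad key copy accompanied by good tests has probability at most
1/(m+1) (`sampling_bound`). For parity this bounds the chance of a wrong sum. For secrecy the
symmetry becomes approximate: the vectors of an outcome and of its flip differ, in total, by 4 times
the projection on X_iX_j = -1 (`sum_flipKey_diff`), which is the event that a hypothetical Hadamard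
measurement of the key copy gives different outcomes for i and j. Sampling bounds this too
(`phase_error_le`). A weighted Cauchy-Schwarz estimate (`born_sub_le`) turns it into a bound of
order 1/√(m+1) on the change of run probabilities under the flip. -/

theorem Matrix.PosSemidef.trace_mul_re_nonneg {α : Type} [Fintype α] {A B : Matrix α α ℂ}
    (hA : A.PosSemidef) (hB : B.PosSemidef) : 0 ≤ (A * B).trace.re := by
  classical
  open scoped MatrixOrder Matrix.Norms.L2Operator in
  obtain ⟨a, rfl⟩ := CStarAlgebra.nonneg_iff_eq_star_mul_self.mp hA.nonneg
  rw [Matrix.mul_assoc, Matrix.trace_mul_comm, Matrix.star_eq_conjTranspose]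
  exact (Complex.le_def.mp (hB.mul_mul_conjTranspose_same a).trace_nonneg).1

/-- Amplitudes of the product vector of the outcomes `out`. -/
def outcomeVec (B : ι → κ → Matrix.unitaryGroup Bit ℂ) (out : ι → κ → Bit)
    (a : ι → κ → Bit) : ℂ :=
  ∏ i, ∏ c, (B i c : Matrix Bit Bit ℂ) (a i c) (out i c)

theorem outcomeProj_eq (B : ι → κ → Matrix.unitaryGroup Bit ℂ) (out : ι → κ → Bit) :
    outcomeProj B out = Matrix.vecMulVec (outcomeVec B out) (star (outcomeVec B out)) := by
  ext a b
  simp [outcomeProj, outcomeVec, Matrix.vecMulVec_apply, Finset.prod_mul_distrib]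

theorem outcomeProj_posSemidef (B : ι → κ → Matrix.unitaryGroup Bit ℂ) (out : ι → κ → Bit) :
    (outcomeProj B out).PosSemidef := by
  rw [outcomeProj_eq]
  exact Matrix.posSemidef_vecMulVec_self_star _

theorem sum_pi_prod {A R : Type} [DecidableEq ι] [Fintype A] [CommSemiring R] (f : ι → A → R) :
    ∑ a : ι → A, ∏ i, f i (a i) = ∏ i, ∑ b, f i b := by
  rw [Finset.prod_univ_sum, Fintype.piFinset_univ]

theorem sum_unitary_mul_star (U : Matrix.unitaryGroup Bit ℂ) (a b : Bit) :
    ∑ r, (U : Matrix Bit Bit ℂ) a r * star ((U : Matrix Bit Bit ℂ) b r) =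
      if a = b then 1 else 0 := by
  have h := congrFun (congrFun (Matrix.mem_unitaryGroup_iff.mp U.2) a) b
  rw [Matrix.mul_apply, Matrix.one_apply] at h
  simpa [Matrix.star_apply] using h

theorem sum_outcomeProj [DecidableEq ι] [DecidableEq κ]
    (B : ι → κ → Matrix.unitaryGroup Bit ℂ) :
    ∑ out, outcomeProj B out = 1 := by
  ext a b
  rw [Matrix.sum_apply]
  simp only [outcomeProj, Matrix.of_apply]
  rw [sum_pi_prod fun i (r : κ → Bit) => ∏ c, (B i c : Matrix Bit Bit ℂ) (a i c) (r c) *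
      star ((B i c : Matrix Bit Bit ℂ) (b i c) (r c))]
  have (i : ι) := sum_pi_prod fun c r => (B i c : Matrix Bit Bit ℂ) (a i c) r *
      star ((B i c : Matrix Bit Bit ℂ) (b i c) r)
  simp only [this, sum_unitary_mul_star, Finset.prod_ite_zero, Finset.prod_const_one,
    Matrix.one_apply, funext_iff, Finset.mem_univ, true_imp_iff]

/-- Moves the allocation from the measurement to the arguments, so that identities need only be
proved with copies indexed by their roles. -/
theorem outcomeVec_perm (B : ι → κ → Matrix.unitaryGroup Bit ℂ) (out : ι → κ → Bit)
    (π : Equiv.Perm κ) (a : ι → κ → Bit) :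
    outcomeVec (fun j c => B j (π c)) (fun j c => out j (π c)) a =
      outcomeVec B out fun j c => a j (π.symm c) := by
  unfold outcomeVec
  refine Finset.prod_congr rfl fun i _ => ?_
  exact Fintype.prod_equiv π _ _ fun c => by simp

/-- Relabelling outcomes by a permutation of the qubits does not change a total measurement. -/
theorem sum_outcomeProj_perm [DecidableEq ι] [DecidableEq κ]
    (B : ι → κ → Matrix.unitaryGroup Bit ℂ) (π : Equiv.Perm κ) :
    ∑ out : ι → κ → Bit, outcomeProj (fun j c => B j (π c)) (fun j c => out j (π c)) = 1 := by
  rw [← sum_outcomeProj fun j c => B j (π c)]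
  exact Fintype.sum_equiv (Equiv.piCongrRight fun _ => Equiv.arrowCongr π.symm (Equiv.refl _))
    _ _ fun out => rfl

end Measurements

/-! ### Expectations of product operators -/

section Born

variable {α β : Type} [Fintype α] [Fintype β]

/-- Expectation of the operator `K ⊗ F` in the state `ρ`. -/
def born (ρ : Matrix (α × β) (α × β) ℂ) : Matrix α α ℂ →ₗ[ℝ] Matrix β β ℂ →ₗ[ℝ] ℝ :=
  LinearMap.mk₂ ℝ (fun K F => (ρ * Matrix.kronecker K F).trace.re)
    (fun K K' F => by
      simp [Matrix.kronecker, Matrix.kroneckerMap_add_left, Matrix.mul_add, add_mul])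
    (fun c K F => by
      rw [Matrix.kronecker, Matrix.kroneckerMap_smul_left _ _ fun _ _ => smul_mul_assoc _ _ _]
      simp)
    (fun K F F' => by
      simp [Matrix.kronecker, Matrix.kroneckerMap_add_right, mul_add])
    (fun c K F => by
      rw [Matrix.kronecker, Matrix.kroneckerMap_smul_right _ _ fun _ _ => mul_smul_comm _ _ _]
      simp)

theorem born_apply (ρ : Matrix (α × β) (α × β) ℂ) (K : Matrix α α ℂ) (F : Matrix β β ℂ) :
    born ρ K F = (ρ * Matrix.kronecker K F).trace.re := rfl

theorem born_nonneg {ρ : Matrix (α × β) (α × β) ℂ} (hρ : ρ.PosSemidef) {K : Matrix α α ℂ}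
    (hK : K.PosSemidef) {F : Matrix β β ℂ} (hF : F.PosSemidef) : 0 ≤ born ρ K F :=
  hρ.trace_mul_re_nonneg (hK.kronecker hF)

theorem born_one_one [DecidableEq α] [DecidableEq β] (ρ : Matrix (α × β) (α × β) ℂ) :
    born ρ 1 1 = ρ.trace.re := by
  simp [born_apply, Matrix.kronecker]

/-- Comparison of two rank-one effects through the sum and the difference of the vectors. -/
theorem born_sub_le {ρ : Matrix (α × β) (α × β) ℂ} (hρ : ρ.PosSemidef) {F : Matrix β β ℂ}
    (hF : F.PosSemidef) (v w : α → ℂ) {l : ℝ} (hl : 0 < l) :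
    |born ρ (Matrix.vecMulVec v (star v)) F - born ρ (Matrix.vecMulVec w (star w)) F| ≤
      l * (born ρ (Matrix.vecMulVec v (star v)) F + born ρ (Matrix.vecMulVec w (star w)) F) +
      l⁻¹ / 2 * born ρ (Matrix.vecMulVec (v - w) (star (v - w))) F := by
  set f := born ρ
  have hsq : ∀ a b : ℝ, 0 ≤ f (Matrix.vecMulVec ((a : ℂ) • (v + w) + (b : ℂ) • (v - w))
      (star ((a : ℂ) • (v + w) + (b : ℂ) • (v - w)))) F := fun a b =>
    born_nonneg hρ (Matrix.posSemidef_vecMulVec_self_star _) hF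
  have hexp : ∀ a b : ℝ, f (Matrix.vecMulVec ((a : ℂ) • (v + w) + (b : ℂ) • (v - w))
      (star ((a : ℂ) • (v + w) + (b : ℂ) • (v - w)))) F =
      a ^ 2 * f (Matrix.vecMulVec (v + w) (star (v + w))) F +
      b ^ 2 * f (Matrix.vecMulVec (v - w) (star (v - w))) F +
      2 * a * b * (f (Matrix.vecMulVec v (star v)) F - f (Matrix.vecMulVec w (star w)) F) := by
    intro a b
    have : Matrix.vecMulVec ((a : ℂ) • (v + w) + (b : ℂ) • (v - w))
      (star ((a : ℂ) • (v + w) + (b : ℂ) • (v - w))) =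
      a ^ 2 • Matrix.vecMulVec (v + w) (star (v + w)) +
      b ^ 2 • Matrix.vecMulVec (v - w) (star (v - w)) +
      (2 * a * b) • (Matrix.vecMulVec v (star v) - Matrix.vecMulVec w (star w)) := by
      ext x y
      simp [Matrix.vecMulVec_apply]
      ring
    rw [this]
    simp only [map_add, map_smul, map_sub, LinearMap.add_apply, LinearMap.smul_apply,
      LinearMap.sub_apply, smul_eq_mul]
  have hpar : f (Matrix.vecMulVec (v + w) (star (v + w))) F =
      2 * (f (Matrix.vecMulVec v (star v)) F + f (Matrix.vecMulVec w (star w)) F) -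
      f (Matrix.vecMulVec (v - w) (star (v - w))) F := by
    have : Matrix.vecMulVec (v + w) (star (v + w)) =
      (2 : ℝ) • (Matrix.vecMulVec v (star v) + Matrix.vecMulVec w (star w)) -
      Matrix.vecMulVec (v - w) (star (v - w)) := by
      ext x y
      simp [Matrix.vecMulVec_apply]
      ring
    rw [this]
    simp only [map_add, map_smul, map_sub, LinearMap.add_apply, LinearMap.smul_apply,
      LinearMap.sub_apply, smul_eq_mul]
  have h1 := hsq l 1
  have h2 := hsq l (-1)
  have h0 : 0 ≤ f (Matrix.vecMulVec (v - w) (star (v - w))) F :=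
    born_nonneg hρ (Matrix.posSemidef_vecMulVec_self_star _) hF
  rw [hexp, hpar] at h1 h2
  have hli : l * l⁻¹ = 1 := mul_inv_cancel₀ hl.ne'
  rw [abs_le]
  constructor
  · refine le_of_mul_le_mul_left ?_ hl
    nlinarith [mul_nonneg (sq_nonneg l) h0]
  · refine le_of_mul_le_mul_left ?_ hl
    nlinarith [mul_nonneg (sq_nonneg l) h0]

end Born

/-! ### The Hadamard basis -/

/-- The nontrivial character of the bits. -/
def bitSign (x : Bit) : ℂ := if x = 0 then 1 else -1

theorem bit_eq_zero_or_one (x : Bit) : x = 0 ∨ x = 1 := by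
  revert x
  decide

theorem sum_bit {M : Type} [AddCommMonoid M] (f : Bit → M) : ∑ r, f r = f 0 + f 1 :=
  Fin.sum_univ_two f

theorem bitSign_zero : bitSign 0 = 1 := if_pos rfl

theorem bitSign_one : bitSign 1 = -1 := if_neg one_ne_zero

theorem bitSign_add (x y : Bit) : bitSign (x + y) = bitSign x * bitSign y := by
  rcases bit_eq_zero_or_one x with rfl | rfl <;> rcases bit_eq_zero_or_one y with rfl | rfl <;>
    simp [bitSign_zero, bitSign_one, show (1 : Bit) + 1 = 0 from rfl]

theorem bitSign_sum {ι : Type} (s : Finset ι) (f : ι → Bit) :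
    bitSign (∑ i ∈ s, f i) = ∏ i ∈ s, bitSign (f i) := by
  classical
  induction s using Finset.induction_on with
  | empty => simp [bitSign_zero]
  | insert a s ha ih => rw [Finset.sum_insert ha, Finset.prod_insert ha, bitSign_add, ih]

theorem star_bitSign (x : Bit) : star (bitSign x) = bitSign x := by
  unfold bitSign
  split_ifs <;> simp

def hadamardMatrix : Matrix Bit Bit ℂ :=
  Matrix.of fun a b => ((Real.sqrt 2)⁻¹ : ℝ) * bitSign (a * b)

theorem star_hadamardMatrix (a b : Bit) : star (hadamardMatrix a b) = hadamardMatrix a b := by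
  simp only [hadamardMatrix, Matrix.of_apply, star_mul', star_bitSign]
  simp

theorem hadamardMatrix_add (a x b : Bit) :
    hadamardMatrix (a + x) b = bitSign (x * b) * hadamardMatrix a b := by
  simp only [hadamardMatrix, Matrix.of_apply, add_mul, bitSign_add]
  ring

theorem hadamardMatrix_mem : hadamardMatrix ∈ Matrix.unitaryGroup Bit ℂ := by
  rw [Matrix.mem_unitaryGroup_iff]
  have h2 : ((Real.sqrt 2 : ℝ) : ℂ)⁻¹ * ((Real.sqrt 2 : ℝ) : ℂ)⁻¹ = 1 / 2 := by
    rw [← mul_inv, ← Complex.ofReal_mul, Real.mul_self_sqrt (by norm_num)]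
    norm_num
  ext a b
  rw [Matrix.mul_apply, sum_bit, Matrix.one_apply]
  simp only [Matrix.star_apply, star_hadamardMatrix]
  rcases bit_eq_zero_or_one a with rfl | rfl <;> rcases bit_eq_zero_or_one b with rfl | rfl <;>
    simp [hadamardMatrix, bitSign_zero, bitSign_one, h2]
  all_goals norm_num

/-- The Hadamard basis, as a unitary matrix. -/
def hadamardBasis : Matrix.unitaryGroup Bit ℂ := ⟨hadamardMatrix, hadamardMatrix_mem⟩

/-- Phase flips of Hadamard outcomes are bit flips. -/
theorem prod_hadamardMatrix_add {ι : Type} [Fintype ι] (v e h : ι → Bit) :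
    ∏ k, hadamardMatrix ((v + e) k) (h k) =
      bitSign (∑ k, e k * h k) * ∏ k, hadamardMatrix (v k) (h k) := by
  simp only [Pi.add_apply, hadamardMatrix_add, Finset.prod_mul_distrib, bitSign_sum]

/-- The pattern of a simultaneous flip of the bits `i` and `j`. -/
def pairFlip {ι : Type} [DecidableEq ι] (i j : ι) : ι → Bit := Pi.single i 1 + Pi.single j 1

section PairFlip

variable {ι : Type} [Fintype ι] [DecidableEq ι] (i j : ι)

omit [Fintype ι] in
theorem pairFlip_add_self : pairFlip i j + pairFlip i j = 0 := by
  ext k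
  exact CharTwo.add_self_eq_zero (R := Bit) _

omit [Fintype ι] in
theorem add_pairFlip_cancel (a : ι → Bit) : a + pairFlip i j + pairFlip i j = a := by
  rw [add_assoc, pairFlip_add_self, add_zero]

theorem sum_pairFlip_mul (h : ι → Bit) : ∑ k, pairFlip i j k * h k = h i + h j := by
  simp [pairFlip, Pi.single_apply, add_mul, Finset.sum_add_distrib]

theorem sum_pairFlip : ∑ k, pairFlip i j k = 0 := by
  have := sum_pairFlip_mul i j 1
  simpa [show (1 : Bit) + 1 = 0 from rfl] using this

omit [Fintype ι] in
theorem eq_add_pairFlip_iff (u a : ι → Bit) :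
    u = a + pairFlip i j ↔ u + pairFlip i j = a :=
  ⟨fun h => by rw [h, add_pairFlip_cancel], fun h => by rw [← h, add_pairFlip_cancel]⟩

/-- Matrix elements of ∑ (|a⟩ - |a+e⟩)(⟨a| - ⟨a+e|) = 2(1 - X_iX_j), where e is the flip pattern. -/
theorem sum_pairFlip_diff (u v : ι → Bit) :
    ∑ a : ι → Bit,
      (((if u = a then 1 else 0) - (if u = a + pairFlip i j then 1 else 0)) *
        ((if v = a then 1 else 0) - (if v = a + pairFlip i j then 1 else 0)) : ℂ) =
      2 * ((if u = v then 1 else 0) - (if u = v + pairFlip i j then 1 else 0)) := by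
  simp only [eq_add_pairFlip_iff, sub_mul, mul_sub, Finset.sum_sub_distrib, ite_mul, one_mul,
    zero_mul, Finset.sum_ite_eq, Finset.mem_univ, if_true]
  have h1 : v + pairFlip i j = u ↔ u + pairFlip i j = v :=
    (eq_add_pairFlip_iff i j v u).symm.trans eq_comm
  have h4 : v = u ↔ u = v := eq_comm
  simp only [h1, h4, add_pairFlip_cancel]
  ring

/-- Hadamard product vectors are eigenvectors of X_iX_j with eigenvalue (-1)^(h_i+h_j), so unequal
outcomes span the eigenspace of -1, with projection (1 - X_iX_j)/2. -/
theorem sum_hadamard_ne (u v : ι → Bit) :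
    ∑ h : ι → Bit, (if h i ≠ h j then (∏ k, hadamardMatrix (u k) (h k)) *
        star (∏ k, hadamardMatrix (v k) (h k)) else 0) =
      1 / 2 * ((if u = v then 1 else 0) - (if u = v + pairFlip i j then 1 else 0)) := by
  have hδ (u v : ι → Bit) : ∑ h : ι → Bit, (∏ k, hadamardMatrix (u k) (h k)) *
      ∏ k, hadamardMatrix (v k) (h k) = if u = v then 1 else 0 := by
    simp only [← Finset.prod_mul_distrib]
    rw [sum_pi_prod fun k r => hadamardMatrix (u k) r * hadamardMatrix (v k) r]
    have (k : ι) := sum_unitary_mul_star hadamardBasis (u k) (v k)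
    simp only [hadamardBasis, star_hadamardMatrix] at this
    simp only [this, Finset.prod_ite_zero, Finset.prod_const_one, funext_iff, Finset.mem_univ,
      true_imp_iff]
  -- Both deltas become sums over h. The flip multiplies a term by its eigenvalue, so the difference
  -- vanishes if h i = h j and is twice the term otherwise.
  rw [← hδ, ← hδ, ← Finset.sum_sub_distrib, Finset.mul_sum]
  refine Finset.sum_congr rfl fun h _ => ?_
  rw [prod_hadamardMatrix_add, sum_pairFlip_mul, star_prod]
  simp only [star_hadamardMatrix]
  by_cases hh : h i = h j
  · simp [hh, CharTwo.add_self_eq_zero, bitSign_zero]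
  · have : h i + h j = 1 := by
      rcases bit_eq_zero_or_one (h i) with h1 | h1 <;>
        rcases bit_eq_zero_or_one (h j) with h2 | h2 <;> simp_all
    rw [if_pos hh, this, bitSign_one]
    ring

end PairFlip

/-! ### Random allocations -/

section Sampling

variable {ι R : Type} [Fintype ι] [DecidableEq ι] [Fintype R] [DecidableEq R]

open Classical in
/-- If the roles in `S` are exchangeable with the role `k`, it is unlikely that `k` is bad while
no role in `S` is. -/
theorem sampling_bound (p : Equiv.Perm R → (ι → R → Bit) → ℝ) (hp : ∀ π out, 0 ≤ p π out)
    (k : R) (S : Finset R) (hk : k ∉ S)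
    (hsymm : ∀ c ∈ S, ∀ π out,
      p (Equiv.swap k c * π) (fun j r => out j (Equiv.swap k c r)) = p π out)
    (bad : (ι → Bit) → Prop) :
    ((S.card : ℝ) + 1) * ∑ π, ∑ out : ι → R → Bit,
      (if bad (fun j => out j k) ∧ ∀ c ∈ S, ¬ bad (fun j => out j c) then p π out else 0) ≤
      ∑ π, ∑ out, p π out := by
  -- The events that c is the only bad role, for c in `insert k S`, are disjoint, and exchanging k
  -- with c shows that they are equally likely. Hence each has at most a 1/(|S|+1) share of the
  -- total weight.
  let only (c : R) (out : ι → R → Bit) : Prop :=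
    bad (fun j => out j c) ∧ ∀ d ∈ insert k S, d ≠ c → ¬ bad (fun j => out j d)
  let Q (c : R) : ℝ := ∑ π, ∑ out, if only c out then p π out else 0
  have hQk : (∑ π, ∑ out : ι → R → Bit,
      (if bad (fun j => out j k) ∧ ∀ c ∈ S, ¬ bad (fun j => out j c) then p π out else 0)) =
      Q k := by
    refine Finset.sum_congr rfl fun π _ => Finset.sum_congr rfl fun out _ => ?_
    congr 1
    refine propext (and_congr_right fun _ => ⟨fun h d hd hdk => ?_, fun h c hc => ?_⟩)
    · exact h d ((Finset.mem_insert.mp hd).resolve_left hdk)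
    · exact h c (Finset.mem_insert_of_mem hc) fun e => hk (e ▸ hc)
  have hQ : ∀ c ∈ insert k S, Q c = Q k := by
    intro c hc
    rcases Finset.mem_insert.mp hc with rfl | hcS
    · rfl
    refine Fintype.sum_equiv (Equiv.mulLeft (Equiv.swap k c)) _ _ fun π => ?_
    refine Fintype.sum_equiv
      (Equiv.piCongrRight fun _ => Equiv.arrowCongr (Equiv.swap k c) (Equiv.refl _)) _ _
      fun out => ?_
    have hout : (Equiv.piCongrRight fun _ : ι =>
        Equiv.arrowCongr (Equiv.swap k c) (Equiv.refl Bit)) out =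
        fun j r => out j (Equiv.swap k c r) := by
      ext j r
      simp [Equiv.arrowCongr]
    rw [hout, Equiv.coe_mulLeft, hsymm c hcS]
    congr 1
    simp only [only, Equiv.swap_apply_left, eq_iff_iff]
    refine and_congr_right fun _ => ⟨fun h d hd hdk => ?_, fun h d hd hdc => ?_⟩
    · by_cases hdc : d = c
      · subst hdc
        rw [Equiv.swap_apply_right]
        exact h k (Finset.mem_insert_self _ _) (Ne.symm hdk)
      · rw [Equiv.swap_apply_of_ne_of_ne hdk hdc]
        exact h d hd hdc
    · by_cases hdk : d = k
      · subst hdk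
        simpa using h c hc (Ne.symm hdc)
      · simpa [Equiv.swap_apply_of_ne_of_ne hdk hdc] using h d hd hdk
  have hcard : ((S.card : ℝ) + 1) * Q k = ∑ c ∈ insert k S, Q c := by
    rw [Finset.sum_congr rfl hQ, Finset.sum_const, Finset.card_insert_of_notMem hk,
      nsmul_eq_mul]
    push_cast
    ring
  rw [hQk, hcard, Finset.sum_comm]
  refine Finset.sum_le_sum fun π _ => ?_
  rw [Finset.sum_comm]
  refine Finset.sum_le_sum fun out _ => ?_
  rw [← Finset.sum_filter, Finset.sum_const, nsmul_eq_mul]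
  refine mul_le_of_le_one_left (hp π out) ?_
  norm_cast
  refine Finset.card_le_one.mpr fun c hc d hd => ?_
  rw [Finset.mem_filter] at hc hd
  by_contra hcd
  exact hc.2.2 d hd.1 (Ne.symm hcd) hd.2.1

open Classical in
/-- The sampling bound for the outcomes of a measurement of randomly allocated qubits. -/
theorem outcomeProj_sampling_bound
    (L : Matrix (ι → R → Bit) (ι → R → Bit) ℂ →ₗ[ℝ] ℝ) (hL : ∀ K, K.PosSemidef → 0 ≤ L K)
    (B : ι → R → Matrix.unitaryGroup Bit ℂ) (k : R) (S : Finset R) (hk : k ∉ S)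
    (hB : ∀ c ∈ S, ∀ j, B j c = B j k) (bad : (ι → Bit) → Prop) :
    ∑ π : Equiv.Perm R, ∑ out : ι → R → Bit,
      (if bad (fun j => out j k) ∧ ∀ c ∈ S, ¬ bad (fun j => out j c) then
        1 / (Fintype.card (Equiv.Perm R) : ℝ) *
          L (outcomeProj (fun j c => B j (π c)) (fun j c => out j (π c))) else 0) ≤
      L 1 / (S.card + 1) := by
  have hcard : (0 : ℝ) < Fintype.card (Equiv.Perm R) := by
    exact_mod_cast Fintype.card_pos
  have h := sampling_bound
    (fun π out => 1 / (Fintype.card (Equiv.Perm R) : ℝ) *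
      L (outcomeProj (fun j c => B j (π c)) (fun j c => out j (π c))))
    (fun π out => mul_nonneg (by positivity) (hL _ (outcomeProj_posSemidef _ _))) k S hk
    -- The swap in the allocation cancels the swap in the outcomes, and the bases agree on k and c,
    -- so the measured operator is unchanged.
    (fun c hc π out => by
      have hB' : ∀ j r, B j (Equiv.swap k c r) = B j r := by
        intro j r
        by_cases h1 : r = k
        · rw [h1, Equiv.swap_apply_left, hB c hc]
        by_cases h2 : r = c
        · rw [h2, Equiv.swap_apply_right, hB c hc]
        rw [Equiv.swap_apply_of_ne_of_ne h1 h2]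
      simp only [Equiv.Perm.coe_mul, Function.comp_apply, Equiv.swap_apply_self, hB']) bad
  have htot : ∑ π : Equiv.Perm R, ∑ out : ι → R → Bit,
      1 / (Fintype.card (Equiv.Perm R) : ℝ) *
        L (outcomeProj (fun j c => B j (π c)) (fun j c => out j (π c))) = L 1 := by
    have (π : Equiv.Perm R) : ∑ out : ι → R → Bit,
        L (outcomeProj (fun j c => B j (π c)) fun j c => out j (π c)) = L 1 := by
      rw [← map_sum, sum_outcomeProj_perm]
    simp only [← Finset.mul_sum, this, Finset.sum_const, Finset.card_univ, nsmul_eq_mul]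
    field_simp
  rw [htot] at h
  rw [le_div_iff₀ (by positivity), mul_comm]
  exact h

end Sampling

/-! ### Outcomes of the key copy and of the test copies -/

section KeyFlip

variable {ι T : Type} [Fintype ι] [DecidableEq ι] [Fintype T] [DecidableEq T]

/-- Outcomes `a` for the key copy and `o` for the test copies. -/
def withKey (a : ι → Bit) (o : ι → T → Bit) : ι → Option T → Bit :=
  fun k c => c.elim (a k) (o k)

/-- The simultaneous flip of the outcomes of `i` and `j` for the key copy. -/
def flipKey (i j : ι) (out : ι → Option T → Bit) : ι → Option T → Bit :=
  withKey ((fun k => out k none) + pairFlip i j) fun k τ => out k (some τ)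

theorem sum_withKey {M : Type} [AddCommMonoid M] (f : (ι → Option T → Bit) → M) :
    ∑ out, f out = ∑ o, ∑ a, f (withKey a o) := by
  rw [← Fintype.sum_prod_type']
  refine Fintype.sum_equiv ⟨fun out => (fun k τ => out k (some τ), fun k => out k none),
    fun p => withKey p.2 p.1, fun out => ?_, fun p => rfl⟩ _ _ fun out => ?_
  · ext k c
    cases c <;> rfl
  · congr 1
    ext k c
    cases c <;> rfl

omit [Fintype ι] [Fintype T] [DecidableEq T] in
theorem flipKey_flipKey (i j : ι) (out : ι → Option T → Bit) :
    flipKey i j (flipKey i j out) = out := by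
  ext k c
  cases c with
  | none => exact congrFun (add_pairFlip_cancel i j fun k => out k none) k
  | some τ => rfl

omit [Fintype ι] [Fintype T] [DecidableEq T] in
theorem flipKey_withKey (i j : ι) (a : ι → Bit) (o : ι → T → Bit) :
    flipKey i j (withKey a o) = withKey (a + pairFlip i j) o := rfl

theorem sum_flipKey {M : Type} [AddCommMonoid M] (i j : ι) (f : (ι → Option T → Bit) → M) :
    ∑ out, f (flipKey i j out) = ∑ out, f out :=
  Equiv.sum_comp (Function.Involutive.toPerm (flipKey i j) (flipKey_flipKey i j)) f

omit [DecidableEq ι] [DecidableEq T] in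
theorem outcomeVec_withKey (B : ι → Option T → Matrix.unitaryGroup Bit ℂ) (a : ι → Bit)
    (o : ι → T → Bit) (u : ι → Option T → Bit) :
    outcomeVec B (withKey a o) u =
      (∏ k, (B k none : Matrix Bit Bit ℂ) (u k none) (a k)) *
        outcomeVec (fun k τ => B k (some τ)) o fun k τ => u k (some τ) := by
  simp only [outcomeVec, Fintype.prod_option, Finset.prod_mul_distrib]
  rfl

open Classical in
/-- Summing the differences of the computational basis vectors of the key copy under a joint flip
gives the projection for different Hadamard outcomes. -/
theorem sum_flipKey_diff (B B' : ι → Option T → Matrix.unitaryGroup Bit ℂ)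
    (hB : ∀ k, B k none = 1) (hB' : ∀ k, B' k none = hadamardBasis)
    (hBB' : ∀ k τ, B k (some τ) = B' k (some τ)) (i j : ι) (good : (ι → T → Bit) → Prop)
    (u v : ι → Option T → Bit) :
    ∑ out : ι → Option T → Bit, (if good (fun k τ => out k (some τ)) then
      (outcomeVec B out u - outcomeVec B (flipKey i j out) u) *
        star (outcomeVec B out v - outcomeVec B (flipKey i j out) v) else 0) =
    4 * ∑ out : ι → Option T → Bit,
      (if out i none ≠ out j none ∧ good (fun k τ => out k (some τ)) then
        outcomeVec B' out u * star (outcomeVec B' out v) else 0) := by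
  rw [sum_withKey, sum_withKey, Finset.mul_sum]
  refine Finset.sum_congr rfl fun o _ => ?_
  have hs (a : ι → Bit) : (fun k τ => withKey a o k (some τ)) = o := rfl
  have hn (a : ι → Bit) (k : ι) : withKey a o k none = a k := rfl
  simp only [hs, hn]
  by_cases ho : good o
  swap
  · simp [ho]
  have h1 (u : ι → Option T → Bit) (a : ι → Bit) :
      ∏ k, (B k none : Matrix Bit Bit ℂ) (u k none) (a k) =
        if (fun k => u k none) = a then 1 else 0 := by
    simp only [hB, Matrix.UnitaryGroup.one_val, Matrix.one_apply, Finset.prod_ite_zero,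
      Finset.prod_const_one, funext_iff, Finset.mem_univ, true_imp_iff]
  simp only [ho, if_true, and_true, flipKey_withKey, outcomeVec_withKey, h1, hB', hBB']
  have hl := sum_pairFlip_diff i j (fun k => u k none) fun k => v k none
  have hr := sum_hadamard_ne i j (fun k => u k none) fun k => v k none
  have hr' : ∑ a : ι → Bit, (if a i ≠ a j then
      (∏ k, (hadamardBasis : Matrix Bit Bit ℂ) (u k none) (a k)) *
        star (∏ k, (hadamardBasis : Matrix Bit Bit ℂ) (v k none) (a k)) else 0) =
      1 / 2 * ((if (fun k => u k none) = (fun k => v k none) then 1 else 0) -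
        if (fun k => u k none) = (fun k => v k none) + pairFlip i j then 1 else 0) := by
    rw [← hr]
    rfl
  set t := outcomeVec (fun k τ => B' k (some τ)) o fun k τ => u k (some τ)
  set t' := outcomeVec (fun k τ => B' k (some τ)) o fun k τ => v k (some τ)
  -- Both sides are a matrix element of 2(1 - X_iX_j) on the key copy times the factor of the test
  -- copies.
  trans (2 * ((if (fun k => u k none) = (fun k => v k none) then 1 else 0) -
        if (fun k => u k none) = (fun k => v k none) + pairFlip i j then 1 else 0)) * (t * star t')
  · rw [← hl, Finset.sum_mul]
    refine Finset.sum_congr rfl fun a _ => ?_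
    simp only [star_sub, star_mul', apply_ite star, star_one, star_zero]
    ring
  · trans 4 * ((∑ a : ι → Bit, (if a i ≠ a j then
      (∏ k, (hadamardBasis : Matrix Bit Bit ℂ) (u k none) (a k)) *
        star (∏ k, (hadamardBasis : Matrix Bit Bit ℂ) (v k none) (a k)) else 0)) * (t * star t'))
    · rw [hr']
      ring
    · rw [Finset.sum_mul]
      congr 1
      refine Finset.sum_congr rfl fun a _ => ?_
      split_ifs
      · rw [star_mul']
        ring
      · rw [zero_mul]

open Classical in
-- The operator form of `sum_flipKey_diff`: its entries are taken at strings relabelled by the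
-- allocation.
theorem sum_flipKey_diff_perm (B B' : ι → Option T → Matrix.unitaryGroup Bit ℂ)
    (hB : ∀ k, B k none = 1) (hB' : ∀ k, B' k none = hadamardBasis)
    (hBB' : ∀ k τ, B k (some τ) = B' k (some τ)) (i j : ι) (good : (ι → T → Bit) → Prop)
    (π : Equiv.Perm (Option T)) :
    ∑ out : ι → Option T → Bit, (if good (fun k τ => out k (some τ)) then
      Matrix.vecMulVec
        (outcomeVec (fun k c => B k (π c)) (fun k c => out k (π c)) -
          outcomeVec (fun k c => B k (π c)) (fun k c => flipKey i j out k (π c)))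
        (star (outcomeVec (fun k c => B k (π c)) (fun k c => out k (π c)) -
          outcomeVec (fun k c => B k (π c)) (fun k c => flipKey i j out k (π c)))) else 0) =
    (4 : ℝ) • ∑ out : ι → Option T → Bit,
      (if out i none ≠ out j none ∧ good (fun k τ => out k (some τ)) then
        outcomeProj (fun k c => B' k (π c)) (fun k c => out k (π c)) else 0) := by
  ext u v
  have h := sum_flipKey_diff B B' hB hB' hBB' i j good (fun k c => u k (π.symm c))
    fun k c => v k (π.symm c)
  simp only [← outcomeVec_perm] at h
  rw [Matrix.smul_apply, Matrix.sum_apply, Matrix.sum_apply]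
  simp only [outcomeProj_eq, Matrix.ite_apply, Matrix.vecMulVec_apply, Pi.sub_apply,
    Pi.star_apply, Matrix.zero_apply]
  rw [h]
  simp

end KeyFlip

/-! ### The protocol -/

/-- Half of the `2 * N * m` test copies of each receiver are measured in the computational basis,
and must have outcomes with sum zero. The others are measured in the Hadamard basis, and must have
equal outcomes. -/
def verifiedSum (N m : ℕ) : GHZProtocol N where
  tests := 2 * (N * m)
  basis _ k _ := if k.val < N * m then 1 else hadamardBasis
  accept _ := {f | ∀ k, (k.val < N * m → ∑ j, f k j = 0) ∧
    (¬ k.val < N * m → ∀ i j, f k i = f k j)}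

section Roles

variable {N m : ℕ}

/-- Roles of the copies that are tested in the computational basis. -/
def parityRoles (N m : ℕ) : Finset (verifiedSum N m).Copy :=
  (Finset.univ.filter fun τ : (verifiedSum N m).Test => τ.2.val < N * m).map
    Function.Embedding.some

/-- Roles of the copies that are tested in the Hadamard basis. -/
def phaseRoles (N m : ℕ) : Finset (verifiedSum N m).Copy :=
  (Finset.univ.filter fun τ : (verifiedSum N m).Test => ¬ τ.2.val < N * m).map
    Function.Embedding.some

theorem none_notMem_parityRoles : none ∉ parityRoles N m := by simp [parityRoles]

theorem none_notMem_phaseRoles : none ∉ phaseRoles N m := by simp [phaseRoles]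

/-- Counting m test copies of a single receiver suffices, since the error bound has to depend on m
only. -/
theorem le_card_parityRoles (hN : 2 ≤ N) : m ≤ (parityRoles N m).card := by
  have hm : m ≤ N * m := Nat.le_mul_of_pos_left m (by omega)
  rw [parityRoles, Finset.card_map]
  let f (k : Fin m) : (verifiedSum N m).Test :=
    (⟨0, by omega⟩, ⟨k.val, show k.val < 2 * (N * m) by omega⟩)
  have hf : Function.Injective f := fun k k' h => by
    simpa [f, Fin.ext_iff] using h
  have := Finset.card_le_card_of_injOn (s := Finset.univ)
    (t := Finset.univ.filter fun τ : (verifiedSum N m).Test => τ.2.val < N * m) f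
    (fun k _ => by
      simp only [Finset.coe_filter, Finset.mem_univ, true_and, Set.mem_ofPred_eq]
      exact lt_of_lt_of_le k.2 hm) hf.injOn
  simpa using this

theorem le_card_phaseRoles (hN : 2 ≤ N) : m ≤ (phaseRoles N m).card := by
  have hm : m ≤ N * m := Nat.le_mul_of_pos_left m (by omega)
  rw [phaseRoles, Finset.card_map]
  let f (k : Fin m) : (verifiedSum N m).Test :=
    (⟨0, by omega⟩, ⟨N * m + k.val, show N * m + k.val < 2 * (N * m) by omega⟩)
  have hf : Function.Injective f := fun k k' h => by
    simpa [f, Fin.ext_iff] using h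
  have := Finset.card_le_card_of_injOn (s := Finset.univ)
    (t := Finset.univ.filter fun τ : (verifiedSum N m).Test => ¬ τ.2.val < N * m) f
    (fun k _ => by
      simp only [Finset.coe_filter, Finset.mem_univ, true_and, Set.mem_ofPred_eq, f]
      omega) hf.injOn
  simpa using this

theorem roleBasis_parity (j : Fin N) {c : (verifiedSum N m).Copy} (hc : c ∈ parityRoles N m) :
    (verifiedSum N m).roleBasis j c = 1 := by
  obtain ⟨τ, hτ, rfl⟩ := Finset.mem_map.mp hc
  exact if_pos (Finset.mem_filter.mp hτ).2

theorem roleBasis_phase (j : Fin N) {c : (verifiedSum N m).Copy} (hc : c ∈ phaseRoles N m) :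
    (verifiedSum N m).roleBasis j c = hadamardBasis := by
  obtain ⟨τ, hτ, rfl⟩ := Finset.mem_map.mp hc
  exact if_neg (Finset.mem_filter.mp hτ).2

/-- The criterion does not depend on the owner of a test copy, so only the type of its role matters.
-/
theorem passes_iff (out : Fin N → (verifiedSum N m).Copy → Bit) :
    (verifiedSum N m).Passes (fun j τ => out j (some τ)) ↔
      (∀ c ∈ parityRoles N m, ∑ j, out j c = 0) ∧
      ∀ c ∈ phaseRoles N m, ∀ i j, out i c = out j c := by
  simp only [parityRoles, phaseRoles, Finset.mem_map, Finset.mem_filter, Finset.mem_univ,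
    true_and, forall_exists_index, and_imp, Function.Embedding.some_apply]
  constructor
  · refine fun h => ⟨?_, ?_⟩
    · rintro c ⟨v, k⟩ hτ rfl
      exact (h v k).1 hτ
    · rintro c ⟨v, k⟩ hτ rfl
      exact (h v k).2 hτ
  · exact fun h v k => ⟨fun hk => h.1 _ (v, k) hk rfl, fun hk => h.2 _ (v, k) hk rfl⟩

end Roles

/-! ### The phase-GHZ state -/

section GHZ

variable {N : ℕ} {κ : Type} [Fintype κ]

/-- The indicator of even parity is half of one plus a character. The sum of the character
factorizes and vanishes, as there is at least one bit. -/
theorem card_even (hN : 1 ≤ N) :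
    ∑ r : Fin N → Bit, (if ∑ i, r i = 0 then (1 : ℂ) else 0) = 2 ^ (N - 1) := by
  have h (x : Bit) : (if x = 0 then (1 : ℂ) else 0) = 1 / 2 * (1 + bitSign x) := by
    unfold bitSign
    split_ifs <;> norm_num
  have hs : ∑ x : Bit, bitSign x = 0 := by
    rw [sum_bit, bitSign_zero, bitSign_one, add_neg_cancel]
  simp only [h, bitSign_sum]
  rw [← Finset.mul_sum, Finset.sum_add_distrib, sum_pi_prod fun _ x => bitSign x]
  simp only [hs, Finset.prod_const, Finset.card_univ, Fintype.card_fin, Finset.sum_const,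
    Fintype.card_pi, ZMod.card, nsmul_eq_mul]
  obtain ⟨k, rfl⟩ : ∃ k, N = k + 1 := ⟨N - 1, by omega⟩
  push_cast
  rw [pow_succ]
  simp only [add_zero, mul_one, ne_eq, Nat.add_eq_zero_iff, one_ne_zero, and_false,
    not_false_eq_true, zero_pow]
  ring

theorem sum_phaseGHZ (hN : 1 ≤ N) : ∑ r, phaseGHZ N r * star (phaseGHZ N r) = 1 := by
  have h (r : Fin N → Bit) : phaseGHZ N r * star (phaseGHZ N r) =
      (2 ^ (N - 1))⁻¹ * if ∑ i, r i = 0 then 1 else 0 := by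
    unfold phaseGHZ
    split_ifs
    · rw [Complex.star_def, Complex.conj_ofReal, ← Complex.ofReal_mul, ← mul_inv,
        Real.mul_self_sqrt (by positivity)]
      simp
    · simp
  simp only [h]
  rw [← Finset.mul_sum, card_even hN, inv_mul_cancel₀ (by positivity)]

/-- The stabilizer X_iX_j: the symmetry behind both the Hadamard test and the secrecy of the mask.
-/
theorem phaseGHZ_add_pairFlip (r : Fin N → Bit) (i j : Fin N) :
    phaseGHZ N (r + pairFlip i j) = phaseGHZ N r := by
  simp only [phaseGHZ, Pi.add_apply, Finset.sum_add_distrib, sum_pairFlip, add_zero]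

theorem sum_piComm {M : Type} [AddCommMonoid M] [DecidableEq κ] (f : (Fin N → κ → Bit) → M) :
    ∑ a, f a = ∑ r : κ → Fin N → Bit, f fun i c => r c i :=
  (Equiv.sum_comp (Equiv.piComm fun _ _ => Bit) fun r : κ → Fin N → Bit => f fun i c => r c i)

theorem ghzSource_isDensity [DecidableEq κ] (hN : 1 ≤ N) : IsDensity (ghzSource N κ) := by
  refine ⟨Matrix.posSemidef_vecMulVec_self_star _, ?_⟩
  simp only [ghzSource, Matrix.trace, Matrix.diag_apply, Matrix.vecMulVec_apply, Pi.star_apply,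
    ghzCopies, star_prod, ← Finset.prod_mul_distrib]
  rw [sum_piComm, sum_pi_prod fun _ (r : Fin N → Bit) => phaseGHZ N r * star (phaseGHZ N r)]
  simp only [sum_phaseGHZ hN, Finset.prod_const_one]

/-- Overlaps of a tensor product of phase-GHZ states and a product vector factorize. -/
theorem outcomeVec_dotProduct_ghzCopies [DecidableEq κ]
    (B : Fin N → κ → Matrix.unitaryGroup Bit ℂ) (out : Fin N → κ → Bit) :
    star (outcomeVec B out) ⬝ᵥ ghzCopies N κ =
      ∏ c, ∑ r : Fin N → Bit,
        (∏ i, star ((B i c : Matrix Bit Bit ℂ) (r i) (out i c))) * phaseGHZ N r := by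
  rw [← sum_pi_prod fun c (r : Fin N → Bit) =>
    (∏ i, star ((B i c : Matrix Bit Bit ℂ) (r i) (out i c))) * phaseGHZ N r, dotProduct, sum_piComm]
  refine Finset.sum_congr rfl fun r _ => ?_
  rw [Finset.prod_mul_distrib, Finset.prod_comm]
  simp [outcomeVec, ghzCopies, star_prod]

theorem ghz_parity_amplitude (a : Fin N → Bit) (ha : ∑ i, a i ≠ 0) :
    ∑ r : Fin N → Bit, (∏ i, star ((1 : Matrix Bit Bit ℂ) (r i) (a i))) * phaseGHZ N r = 0 := by
  refine Finset.sum_eq_zero fun r _ => ?_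
  by_cases h : r = a
  · rw [h, phaseGHZ, if_neg ha, mul_zero]
  · obtain ⟨i, hi⟩ := Function.ne_iff.mp h
    rw [Finset.prod_eq_zero (Finset.mem_univ i), zero_mul]
    simp [hi]

/-- The joint flip fixes the state but changes the sign of the Hadamard product vector, so the
overlap equals its own negative. -/
theorem ghz_phase_amplitude (a : Fin N → Bit) (i j : Fin N) (ha : a i ≠ a j) :
    ∑ r : Fin N → Bit, (∏ k, star (hadamardMatrix (r k) (a k))) * phaseGHZ N r = 0 := by
  simp only [star_hadamardMatrix]
  have h := Equiv.sum_comp (Equiv.addRight (pairFlip i j))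
    fun r : Fin N → Bit => (∏ k, hadamardMatrix (r k) (a k)) * phaseGHZ N r
  simp only [Equiv.coe_addRight, phaseGHZ_add_pairFlip, prod_hadamardMatrix_add,
    sum_pairFlip_mul] at h
  have h1 : a i + a j = 1 := by
    rcases bit_eq_zero_or_one (a i) with h1 | h1 <;>
      rcases bit_eq_zero_or_one (a j) with h2 | h2 <;> simp_all
  simp only [h1, bitSign_one, mul_assoc, ← Finset.mul_sum] at h
  linear_combination -(1 / 2 : ℂ) * h

end GHZ

/-! ### Honest receivers -/

section HonestRun

variable {N : ℕ}

/-- Expectation of an operator, as a functional. -/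
def expect {α : Type} [Fintype α] (ρ : Matrix α α ℂ) : Matrix α α ℂ →ₗ[ℝ] ℝ where
  toFun K := (ρ * K).trace.re
  map_add' K K' := by simp [Matrix.mul_add]
  map_smul' c K := by simp

namespace GHZProtocol

theorem honestProb_nonneg (P : GHZProtocol N)
    {ρ : Matrix (Fin N → P.Copy → Bit) (Fin N → P.Copy → Bit) ℂ} (hρ : IsDensity ρ)
    (π : P.Allocation) (out : Fin N → P.Copy → Bit) : 0 ≤ P.honestProb ρ π out :=
  mul_nonneg (by positivity) (hρ.1.trace_mul_re_nonneg (outcomeProj_posSemidef _ _))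

theorem sum_honestProb (P : GHZProtocol N)
    {ρ : Matrix (Fin N → P.Copy → Bit) (Fin N → P.Copy → Bit) ℂ} (hρ : IsDensity ρ) :
    ∑ π, ∑ out, P.honestProb ρ π out = 1 := by
  have hcard : (0 : ℝ) < Fintype.card P.Allocation := by exact_mod_cast Fintype.card_pos
  have h (π : P.Allocation) : ∑ out : Fin N → P.Copy → Bit,
      expect ρ (outcomeProj (fun j c => P.roleBasis j (π c)) fun j c => out j (π c)) = 1 := by
    rw [← map_sum, sum_outcomeProj_perm]
    simp [expect, hρ.2]
  calc ∑ π, ∑ out, P.honestProb ρ π out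
      = ∑ π : P.Allocation, 1 / (Fintype.card P.Allocation : ℝ) *
        ∑ out : Fin N → P.Copy → Bit, expect ρ
          (outcomeProj (fun j c => P.roleBasis j (π c)) fun j c => out j (π c)) := by
        simp only [Finset.mul_sum]
        rfl
    _ = 1 := by
        simp only [h, mul_one, Finset.sum_const, Finset.card_univ, nsmul_eq_mul]
        field_simp

open Classical in
-- The coordinator is the image of the distribution of runs under `output`, so probabilities of
-- events can be computed on runs.
theorem sum_coordinator (P : GHZProtocol N)
    (ρ : Matrix (Fin N → P.Copy → Bit) (Fin N → P.Copy → Bit) ℂ) (n : ℕ)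
    (x : Fin N → Fin n → Bit) (A : (Fin N → Fin n → Option Bit) → Prop) :
    ∑ γ, (if A γ then P.coordinator ρ n x γ else 0) =
      ∑ π, ∑ out, if A (fun _ => P.output out x) then P.honestProb ρ π out else 0 := by
  simp only [coordinator, ← Finset.sum_filter A, ← funext_iff (g := fun _ => P.output _ x)]
  rw [Finset.sum_comm]
  refine Finset.sum_congr rfl fun π _ => ?_
  rw [Finset.sum_comm]
  refine Finset.sum_congr rfl fun out _ => ?_
  simp only [Finset.sum_ite_eq', Finset.mem_filter, Finset.mem_univ, true_and]

theorem coordinator_isChannel (P : GHZProtocol N)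
    {ρ : Matrix (Fin N → P.Copy → Bit) (Fin N → P.Copy → Bit) ℂ} (hρ : IsDensity ρ) (n : ℕ) :
    IsChannel (P.coordinator ρ n) := by
  classical
  refine fun x => ⟨fun γ => ?_, ?_⟩
  · refine Finset.sum_nonneg fun π _ => Finset.sum_nonneg fun out _ => ?_
    split_ifs
    · exact P.honestProb_nonneg hρ π out
    · exact le_rfl
  · have h := P.sum_coordinator ρ n x fun _ => True
    simpa only [if_true, P.sum_honestProb hρ] using h

end GHZProtocol

/-- Code for a channel whose states are known to the receivers: all words are code words. -/
def xorCode (N n : ℕ) : BroadcastCode N n (Option Bit) where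
  size _ := 2 ^ n
  size_pos _ := by positivity
  encode msg i :=
    (Fintype.equivFinOfCardEq (α := Fin n → Bit) (n := 2 ^ n) (by simp [ZMod.card])).symm (msg i)
  -- Adding the code bit to the received bit recovers the state, so the decoder picks the message
  -- consistent with the known states. An aborted position matches no message.
  decodeSet _ γ k := {y | ∀ t, γ t = some (y t +
    (Fintype.equivFinOfCardEq (α := Fin n → Bit) (n := 2 ^ n) (by simp [ZMod.card])).symm k t)}
  decodeSet_disjoint i γ j k hjk := by
    refine Set.disjoint_left.mpr fun y hj hk => hjk ?_
    refine (Fintype.equivFinOfCardEq (α := Fin n → Bit) (n := 2 ^ n)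
      (by simp [ZMod.card])).symm.injective (funext fun t => ?_)
    have := (hj t).symm.trans (hk t)
    simpa using this

theorem stateChannel_add (s u : Bit) : stateChannel s u + u = s := by
  revert s u
  decide

/-- If the receivers obtain the channel states with certainty, all rates one are achievable. -/
theorem achievable_one (q : ∀ n, Coordinator N n (Option Bit)) (hq : ∀ n, IsChannel (q n))
    (h : ∀ n x, q n x (fun _ t => some (channelState x t)) = 1) :
    Achievable q fun _ => 1 := by
  classical
  refine ⟨hq, fun n => xorCode N n, fun i => ?_, ?_⟩
  · refine le_liminf_of_le (by isBoundedDefault) ?_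
    -- At n = 0 the quotient is 0 by the convention 1/0 = 0, so the rate is one only from n = 1 on.
    filter_upwards [eventually_ge_atTop 1] with n hn
    have hn' : (n : ℝ) ≠ 0 := by positivity
    have : (1 / (n : ℝ) * Real.logb 2 ((xorCode N n).size i) : ℝ) = 1 := by
      have : ((xorCode N n).size i : ℝ) = 2 ^ n := by simp [xorCode]
      rw [this, Real.logb_pow, Real.logb_self_eq_one one_lt_two, mul_one, one_div,
        inv_mul_cancel₀ hn']
    rw [this]
  · have hs : ∀ n, successProb (q n) (xorCode N n) = 1 := by
      intro n
      have hx (msg : ∀ i, Fin ((xorCode N n).size i)) (x : Fin N → Fin n → Bit) :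
          ∑ γ : Fin N → Fin n → Option Bit, q n x γ * ∏ i,
            (if channelOutput (channelState x) ((xorCode N n).encode msg i) ∈
              (xorCode N n).decodeSet i (γ i) (msg i) then (1 : ℝ) else 0) = 1 := by
        -- A row of a channel has total weight one, already exhausted by the correct word.
        have h0 : ∀ γ, γ ≠ (fun _ t => some (channelState x t)) → q n x γ = 0 := by
          intro γ hγ
          have := (hq n x).2
          rw [← Finset.add_sum_erase _ _
            (Finset.mem_univ (fun _ t => some (channelState x t))), h, add_eq_left] at this
          exact (Finset.sum_eq_zero_iff_of_nonneg fun γ _ => (hq n x).1 γ).mp this γ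
            (Finset.mem_erase.mpr ⟨hγ, Finset.mem_univ _⟩)
        rw [Finset.sum_eq_single (fun _ t => some (channelState x t))
          (fun γ _ hγ => by rw [h0 γ hγ, zero_mul]) (fun hn => absurd (Finset.mem_univ _) hn),
          h, one_mul]
        refine Finset.prod_eq_one fun i _ => if_pos fun t => ?_
        exact congrArg some (stateChannel_add _ _).symm
      rw [successProb]
      simp only [hx, Finset.sum_const, Finset.card_univ, nsmul_eq_mul, mul_one, Fintype.card_pi,
        Fintype.card_fin, ZMod.card, Finset.prod_const]
      push_cast
      rw [← pow_mul, mul_comm n N, one_div, inv_mul_cancel₀]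
      have : ∀ i, ((xorCode N n).size i : ℝ) ≠ 0 := fun i =>
        Nat.cast_ne_zero.mpr ((xorCode N n).size_pos i).ne'
      exact mul_ne_zero (Finset.prod_ne_zero_iff.mpr fun i _ => this i) (by positivity)
    simp [hs]

variable {m : ℕ}

/-- The amplitude is a product over copies, so one forbidden copy suffices: an odd sum on the key or
a parity copy, or unequal outcomes on a phase copy. -/
theorem verifiedSum_honestProb_eq_zero (π : (verifiedSum N m).Allocation)
    (out : Fin N → (verifiedSum N m).Copy → Bit)
    (h : ¬ ((verifiedSum N m).Passes (fun j τ => out j (some τ)) ∧ ∑ j, out j none = 0)) :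
    (verifiedSum N m).honestProb (ghzSource N _) π out = 0 := by
  have hz : star (outcomeVec (fun j c => (verifiedSum N m).roleBasis j (π c))
      fun j c => out j (π c)) ⬝ᵥ ghzCopies N _ = 0 := by
    rw [outcomeVec_dotProduct_ghzCopies]
    suffices ∃ c, ∑ r : Fin N → Bit, (∏ i, star (((verifiedSum N m).roleBasis i c :
        Matrix Bit Bit ℂ) (r i) (out i c))) * phaseGHZ N r = 0 by
      obtain ⟨c, hc⟩ := this
      refine Finset.prod_eq_zero (Finset.mem_univ (π.symm c)) ?_
      simpa only [Equiv.apply_symm_apply] using hc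
    rw [passes_iff] at h
    by_cases h1 : ∃ c ∈ insert none (parityRoles N m), ∑ j, out j c ≠ 0
    · obtain ⟨c, hc, hne⟩ := h1
      have hb : ∀ i, (verifiedSum N m).roleBasis i c = 1 := by
        intro i
        rcases Finset.mem_insert.mp hc with rfl | hc
        · rfl
        · exact roleBasis_parity i hc
      refine ⟨c, ?_⟩
      simp only [hb]
      exact ghz_parity_amplitude (fun i => out i c) hne
    by_cases h2 : ∃ c ∈ phaseRoles N m, ∃ i j, out i c ≠ out j c
    · obtain ⟨c, hc, i, j, hne⟩ := h2
      refine ⟨c, ?_⟩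
      simp only [roleBasis_phase _ hc]
      exact ghz_phase_amplitude (fun i => out i c) i j hne
    · push Not at h1 h2
      exact absurd ⟨⟨fun c hc => h1 c (Finset.mem_insert_of_mem hc), h2⟩,
        h1 none (Finset.mem_insert_self _ _)⟩ h
  rw [GHZProtocol.honestProb, outcomeProj_eq, ghzSource, Matrix.vecMulVec_mul_vecMulVec,
    Matrix.trace_vecMulVec, dotProduct_smul, dotProduct_comm (ghzCopies N _), hz]
  simp

theorem verifiedSum_reliable (hN : 1 ≤ N) : (verifiedSum N m).Reliable := by
  classical
  intro n x
  -- With 1 written as the total probability of all runs, it remains to compare term by term: runs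
  -- that do not yield the channel states have probability zero.
  rw [← (verifiedSum N m).sum_honestProb (ghzSource_isDensity hN)]
  refine Finset.sum_congr rfl fun π _ => Finset.sum_congr rfl fun out _ => ?_
  by_cases h : (verifiedSum N m).Passes (fun j τ => out j (some τ)) ∧ ∑ j, out j none = 0
  · refine if_pos fun _ => ?_
    rw [GHZProtocol.output, if_pos h.1]
    simp only [Finset.sum_add_distrib, h.2, add_zero, channelState]
  · rw [verifiedSum_honestProb_eq_zero π out h, ite_self]

theorem verifiedSum_achievable (hN : 1 ≤ N) :
    Achievable ((verifiedSum N m).coordinator (ghzSource N (verifiedSum N m).Copy))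
      fun _ => 1 :=
  achievable_one _ (fun n => (verifiedSum N m).coordinator_isChannel (ghzSource_isDensity hN) n)
    (verifiedSum_reliable hN)

/-- A wrong state without abort means odd parity on the key copy and even parity on all
parity-tested copies. All of these are measured in the computational basis, so the sampling bound
applies. -/
theorem verifiedSum_verifiesSum (hN : 2 ≤ N) :
    (verifiedSum N m).VerifiesSum (1 / (m + 1)) := by
  classical
  intro ρ hρ n x
  refine (le_of_eq (Eq.trans ?_ ((verifiedSum N m).sum_coordinator ρ n x
    fun γ => ∃ i t s, γ i t = some s ∧ s ≠ channelState x t))).trans ?_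
  · congr!
  have hs := outcomeProj_sampling_bound (expect ρ) (fun K hK => hρ.1.trace_mul_re_nonneg hK)
    (verifiedSum N m).roleBasis none (parityRoles N m) none_notMem_parityRoles
    (fun c hc j => roleBasis_parity j hc) fun a => ∑ j, a j ≠ 0
  have h1 : expect ρ 1 = 1 := by simp [expect, hρ.2]
  rw [h1] at hs
  refine le_trans (Finset.sum_le_sum fun π _ => Finset.sum_le_sum fun out _ => ?_)
    (hs.trans ?_)
  · split_ifs with h h' h'
    · exact le_rfl
    · exfalso
      obtain ⟨i, t, s, hts, hne⟩ := h
      by_cases hp : (verifiedSum N m).Passes fun j τ => out j (some τ)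
      · rw [GHZProtocol.output, if_pos hp, Option.some_inj] at hts
        refine h' ⟨fun h0 => hne ?_, fun c hc => not_not.mpr ((passes_iff out).mp hp |>.1 c hc)⟩
        rw [← hts, Finset.sum_add_distrib, h0, add_zero, channelState]
      · rw [GHZProtocol.output, if_neg hp] at hts
        exact absurd hts (by simp)
    · exact (verifiedSum N m).honestProb_nonneg hρ π out
    · exact le_rfl
  · gcongr
    exact le_card_parityRoles hN

end HonestRun

/-! ### Joint distributions with a flip symmetry -/

section FlipSymmetry

variable {Ω V : Type} [Fintype Ω] [Fintype V] (f : Ω → ℝ) (b : Ω → Bit) (view : Ω → V)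
  (G : Ω → Ω)

open Classical in
/-- Joint distribution of `b` and `view` under the weights `f`. -/
def jointLaw (r : Bit) (v : V) : ℝ := ∑ ω, if b ω = r ∧ v = view ω then f ω else 0

open Classical in
omit [Fintype V] in
-- Reindexing by `G` carries the event b = 1 to b = 0 and keeps the view, so both laws become sums
-- over the same runs.
theorem jointLaw_sub (hG : Function.Involutive G) (hb : ∀ ω, b (G ω) = b ω + 1)
    (hv : ∀ ω, view (G ω) = view ω) (v : V) :
    jointLaw f b view 0 v - jointLaw f b view 1 v =
      ∑ ω, if b ω = 0 ∧ v = view ω then f ω - f (G ω) else 0 := by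
  have h1 : jointLaw f b view 1 v = ∑ ω, if b ω = 0 ∧ v = view ω then f (G ω) else 0 := by
    rw [jointLaw, ← Equiv.sum_comp (hG.toPerm G)]
    refine Finset.sum_congr rfl fun ω _ => ?_
    simp only [Function.Involutive.coe_toPerm, hb, hv, add_eq_right]
  rw [h1, jointLaw, ← Finset.sum_sub_distrib]
  refine Finset.sum_congr rfl fun ω _ => ?_
  split_ifs <;> simp

open Classical in
-- The triangle inequality in the previous formula. Dropping the restriction b = 0 costs a harmless
-- factor two.
theorem sum_abs_jointLaw_le (hG : Function.Involutive G) (hb : ∀ ω, b (G ω) = b ω + 1)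
    (hv : ∀ ω, view (G ω) = view ω) (good : V → Prop) :
    ∑ v, (if good v then |jointLaw f b view 0 v - jointLaw f b view 1 v| else 0) ≤
      ∑ ω, if good (view ω) then |f ω - f (G ω)| else 0 := by
  have h (v : V) : (if good v then |jointLaw f b view 0 v - jointLaw f b view 1 v| else 0) ≤
      ∑ ω, if v = view ω then (if good (view ω) then |f ω - f (G ω)| else 0) else 0 := by
    rw [jointLaw_sub f b view G hG hb hv]
    split_ifs with hg
    · refine (Finset.abs_sum_le_sum_abs _ _).trans (Finset.sum_le_sum fun ω _ => ?_)
      by_cases h1 : v = view ω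
      · subst h1
        simp only [and_true, if_true, hg]
        split_ifs <;> simp
      · simp [h1]
    · exact Finset.sum_nonneg fun ω _ => by split_ifs <;> simp
  refine (Finset.sum_le_sum fun v _ => h v).trans ?_
  rw [Finset.sum_comm]
  simp

omit [Fintype V] in
theorem jointLaw_eq (hG : Function.Involutive G) (hb : ∀ ω, b (G ω) = b ω + 1)
    (hv : ∀ ω, view (G ω) = view ω) (hf : ∀ ω, f (G ω) = f ω) (v : V) :
    jointLaw f b view 0 v = jointLaw f b view 1 v := by
  classical
  rw [← sub_eq_zero, jointLaw_sub f b view G hG hb hv]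
  simp [hf]

theorem sum_jointLaw : ∑ r, ∑ v, jointLaw f b view r v = ∑ ω, f ω := by
  classical
  have h (r : Bit) : ∑ v, jointLaw f b view r v = ∑ ω, if b ω = r then f ω else 0 := by
    simp only [jointLaw]
    rw [Finset.sum_comm]
    refine Finset.sum_congr rfl fun ω _ => ?_
    by_cases hb : b ω = r <;> simp [hb]
  simp only [h]
  rw [Finset.sum_comm]
  simp

end FlipSymmetry

/-- With q the common value of both rows, log(2q) = 1 + log q shows that the joint entropy exceeds
that of the view by exactly one bit, the entropy of the uniform bit. The case q = 0 is separate. -/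
theorem mutualInformation_eq_zero {V : Type} [Fintype V] (J : Bit → V → ℝ)
    (h : ∀ v, J 0 v = J 1 v) (hJ : ∑ v, J 0 v = 1 / 2) : mutualInformation J = 0 := by
  have h2 : Real.logb 2 (1 / 2) = -1 := by
    rw [one_div, Real.logb_inv, Real.logb_self_eq_one one_lt_two]
  have hm (q : ℝ) : -((q + q) * Real.logb 2 (q + q)) = -(2 * q) - 2 * (q * Real.logb 2 q) := by
    rcases eq_or_ne q 0 with rfl | hq
    · simp
    · rw [← two_mul, Real.logb_mul two_ne_zero hq, Real.logb_self_eq_one one_lt_two]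
      ring
  simp only [mutualInformation, shannonEntropy, Fintype.sum_prod_type, sum_bit, hJ, h2, ← h,
    hm, Finset.sum_sub_distrib, Finset.sum_neg_distrib, ← Finset.mul_sum]
  ring

/-! ### Attacks -/

namespace GHZProtocol

variable {N n : ℕ} {P : GHZProtocol N} {Z : Finset (Fin N)} {E Y : Type} [Fintype E]
  [DecidableEq E] [Fintype Y]

/-- What happens in a run under attack: state information, allocation, outcomes of the honest
receivers, announcement and result of the coalition. -/
abbrev Run (P : GHZProtocol N) (n : ℕ) (Z : Finset (Fin N)) (Y : Type) :=
  (Fin N → Fin n → Bit) × P.Allocation × (Honest Z → P.Copy → Bit) ×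
    (Colluding Z → P.Test → Bit) × Y

/-- Probability of a run. -/
def runProb (ρ : Matrix ((Honest Z → P.Copy → Bit) × E) ((Honest Z → P.Copy → Bit) × E) ℂ)
    (A : P.Attack n Z E Y) (ω : P.Run n Z Y) : ℝ :=
  attackProb ρ A ω.1 ω.2.1 ω.2.2.1 ω.2.2.2.1 ω.2.2.2.2

/-- The view of the coalition in a run. -/
def runView (ω : P.Run n Z Y) : P.View n Z Y :=
  (ω.2.1, announced ω.2.2.1 ω.2.2.2.1, maskedInfo ω.2.2.1 ω.2.2.2.1 ω.1,
    (fun j : Colluding Z => ω.1 j), channelState ω.1, ω.2.2.2.2)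

theorem maskViewProb_eq
    (ρ : Matrix ((Honest Z → P.Copy → Bit) × E) ((Honest Z → P.Copy → Bit) × E) ℂ)
    (A : P.Attack n Z E Y) (i : Honest Z) (r : Bit) (v : P.View n Z Y) :
    maskViewProb ρ A i r v = jointLaw (runProb ρ A) (fun ω => ω.2.2.1 i none) runView r v := by
  classical
  simp only [maskViewProb, jointLaw, Fintype.sum_prod_type]
  refine Finset.sum_congr rfl fun x _ => Finset.sum_congr rfl fun π _ =>
    Finset.sum_congr rfl fun out _ => Finset.sum_congr rfl fun c _ =>
    Finset.sum_congr rfl fun y _ => ?_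
  by_cases h : out i none = r ∧ v = runView (x, π, out, c, y)
  · exact (if_pos h).trans (if_pos h).symm
  · exact (if_neg h).trans (if_neg h).symm

/-- The flip of the key outcomes of `i` and `j`, compensated by a flip of their state
information. -/
def flipRun (i j : Honest Z) (ω : P.Run n Z Y) : P.Run n Z Y :=
  (fun k t => ω.1 k t + pairFlip (i : Fin N) j k, ω.2.1, flipKey i j ω.2.2.1, ω.2.2.2)

theorem pairFlip_coe (i j k : Honest Z) : pairFlip (i : Fin N) j k = pairFlip i j k := by
  simp [pairFlip, Pi.single_apply, Subtype.ext_iff]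

theorem pairFlip_colluding (i j : Honest Z) (k : Colluding Z) :
    pairFlip (i : Fin N) j k = 0 := by
  have hi : (k : Fin N) ≠ i := fun h => i.2 (h ▸ k.2)
  have hj : (k : Fin N) ≠ j := fun h => j.2 (h ▸ k.2)
  simp [pairFlip, hi, hj]

omit [Fintype Y] in
theorem flipRun_involutive (i j : Honest Z) :
    Function.Involutive (flipRun (P := P) (n := n) (Y := Y) i j) := by
  intro ω
  refine Prod.ext (funext fun k => funext fun t => ?_)
    (Prod.ext rfl (Prod.ext (flipKey_flipKey i j _) rfl))
  simp only [flipRun]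
  rw [add_assoc, ← Pi.add_apply, pairFlip_add_self, Pi.zero_apply, add_zero]

omit [Fintype Y] in
theorem allocation_flipRun (i j : Honest Z) (ω : P.Run n Z Y) :
    (flipRun i j ω).2.1 = ω.2.1 := rfl

omit [Fintype Y] in
theorem outcomes_flipRun (i j : Honest Z) (ω : P.Run n Z Y) :
    (flipRun i j ω).2.2.1 = flipKey i j ω.2.2.1 := rfl

omit [Fintype Y] in
-- In each masked bit the flips of key outcome and state information cancel; in each channel state
-- the flips of i and j cancel. Test outcomes and the coalition's own data are untouched because i
-- and j are honest.
theorem runView_flipRun (i j : Honest Z) (ω : P.Run n Z Y) :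
    runView (flipRun i j ω) = runView ω := by
  obtain ⟨x, π, out, c, y⟩ := ω
  have hann : announced (flipKey i j out) c = announced out c := rfl
  have hch : channelState (fun k t => x k t + pairFlip (i : Fin N) j k) = channelState x := by
    ext t
    simp only [channelState, Finset.sum_add_distrib, sum_pairFlip, add_zero]
  have hmask : maskedInfo (flipKey i j out) c (fun k t => x k t + pairFlip (i : Fin N) j k) =
      maskedInfo out c x := by
    simp only [maskedInfo, hann]
    congr 2
    ext k t
    have : flipKey i j out k none = out k none + pairFlip i j k := rfl
    rw [this, pairFlip_coe, add_comm (out k none), ← add_assoc, add_assoc (x k t),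
      ← Pi.add_apply, pairFlip_add_self, Pi.zero_apply, add_zero]
  simp only [runView, flipRun, hann, hch, hmask, pairFlip_colluding, add_zero]

omit [Fintype Y] in
theorem key_flipRun {i j : Honest Z} (hij : i ≠ j) (ω : P.Run n Z Y) :
    (flipRun i j ω).2.2.1 i none = ω.2.2.1 i none + 1 := by
  have : (flipRun i j ω).2.2.1 i none = ω.2.2.1 i none + pairFlip i j i := rfl
  rw [this]
  simp [pairFlip, hij]

/-- The operator that the coalition measures in a run. -/
def runEffect (A : P.Attack n Z E Y) (ω : P.Run n Z Y) : Matrix E E ℂ :=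
  A.effect (fun j : Colluding Z => ω.1 j) (channelState ω.1) ω.2.1
    (fun j τ => ω.2.2.1 j (some τ)) ω.2.2.2.1 (maskedInfo ω.2.2.1 ω.2.2.2.1 ω.1) ω.2.2.2.2

/-- The coalition can only choose its measurement from data that the flip preserves. -/
theorem runEffect_flipRun (A : P.Attack n Z E Y) (i j : Honest Z) (ω : P.Run n Z Y) :
    runEffect A (flipRun i j ω) = runEffect A ω := by
  have h := runView_flipRun i j ω
  simp only [runView, Prod.mk.injEq] at h
  obtain ⟨-, -, h3, h4, h5, -⟩ := h
  unfold runEffect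
  rw [h3, h4, h5]
  rfl

/-- The bases of the honest receivers for each role. -/
def honestBasis (P : GHZProtocol N) (Z : Finset (Fin N)) (j : Honest Z) (c : P.Copy) :
    Matrix.unitaryGroup Bit ℂ :=
  P.roleBasis j c

/-- Product vector of the outcomes of the honest receivers. -/
def honestVec (P : GHZProtocol N) {Z : Finset (Fin N)} (π : P.Allocation)
    (out : Honest Z → P.Copy → Bit) : (Honest Z → P.Copy → Bit) → ℂ :=
  outcomeVec (fun j c => honestBasis P Z j (π c)) fun j c => out j (π c)

theorem runProb_eq
    (ρ : Matrix ((Honest Z → P.Copy → Bit) × E) ((Honest Z → P.Copy → Bit) × E) ℂ)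
    (A : P.Attack n Z E Y) (ω : P.Run n Z Y) :
    runProb ρ A ω = 1 / (2 ^ (N * n) * (Fintype.card P.Allocation : ℝ)) *
      born ρ (Matrix.vecMulVec (honestVec P ω.2.1 ω.2.2.1) (star (honestVec P ω.2.1 ω.2.2.1)))
        (runEffect A ω) := by
  rw [honestVec, ← outcomeProj_eq]
  rfl

/-- Expectations of operators that do not depend on what the coalition does. -/
theorem sum_run_born
    (ρ : Matrix ((Honest Z → P.Copy → Bit) × E) ((Honest Z → P.Copy → Bit) × E) ℂ)
    (A : P.Attack n Z E Y)
    (K : P.Allocation → (Honest Z → P.Copy → Bit) →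
      Matrix (Honest Z → P.Copy → Bit) (Honest Z → P.Copy → Bit) ℂ) :
    ∑ ω : P.Run n Z Y, 1 / (2 ^ (N * n) * (Fintype.card P.Allocation : ℝ)) *
      born ρ (K ω.2.1 ω.2.2.1) (runEffect A ω) =
    ∑ π, 1 / (Fintype.card P.Allocation : ℝ) * born ρ (∑ out, K π out) 1 := by
  have hcard : (0 : ℝ) < Fintype.card P.Allocation := by exact_mod_cast Fintype.card_pos
  have h (x : Fin N → Fin n → Bit) (π : P.Allocation) (out : Honest Z → P.Copy → Bit) :
      ∑ c, ∑ y, born ρ (K π out) (runEffect A (x, π, out, c, y)) = born ρ (K π out) 1 := by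
    simp only [runEffect]
    -- The sum over `y` gives `claim`, which does not depend on the masked information; therefore
    -- the sum over `c` gives the identity.
    rw [← A.sum_claim (fun j : Colluding Z => x j) (channelState x) π
      (fun j τ => out j (some τ)), map_sum]
    refine Finset.sum_congr rfl fun c _ => ?_
    rw [← A.sum_effect _ _ _ _ _ (maskedInfo out c x), map_sum]
  simp only [Fintype.sum_prod_type, ← Finset.mul_sum, h, map_sum, LinearMap.sum_apply,
    Finset.sum_const, Finset.card_univ, nsmul_eq_mul, Fintype.card_pi, ZMod.card,
    Finset.prod_const, Fintype.card_fin]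
  push_cast
  rw [← pow_mul, mul_comm n N]
  field_simp

theorem sum_honestVec (π : P.Allocation) :
    ∑ out : Honest Z → P.Copy → Bit,
      Matrix.vecMulVec (honestVec P π out) (star (honestVec P π out)) = 1 := by
  simp only [honestVec, ← outcomeProj_eq]
  exact sum_outcomeProj_perm (honestBasis P Z) π

theorem sum_avg (a : ℝ) :
    ∑ _π : P.Allocation, 1 / (Fintype.card P.Allocation : ℝ) * a = a := by
  have hcard : (0 : ℝ) < Fintype.card P.Allocation := by exact_mod_cast Fintype.card_pos
  simp only [Finset.sum_const, Finset.card_univ, nsmul_eq_mul]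
  field_simp

theorem sum_runProb
    {ρ : Matrix ((Honest Z → P.Copy → Bit) × E) ((Honest Z → P.Copy → Bit) × E) ℂ}
    (hρ : ρ.trace = 1) (A : P.Attack n Z E Y) : ∑ ω, runProb ρ A ω = 1 := by
  simp only [runProb_eq]
  rw [sum_run_born ρ A fun π out =>
    Matrix.vecMulVec (honestVec P π out) (star (honestVec P π out))]
  simp only [sum_honestVec, born_one_one, hρ, sum_avg, Complex.one_re]

/-- The bound on the size of the coalition provides the partner for the joint flip. -/
theorem exists_other_honest (hZ : Z.card + 2 ≤ N) (i : Honest Z) : ∃ j : Honest Z, i ≠ j := by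
  have hc : 1 < (Zᶜ).card := by
    rw [Finset.card_compl, Fintype.card_fin]
    omega
  obtain ⟨j, hj, hji⟩ := Finset.exists_mem_ne hc i
  exact ⟨⟨j, Finset.mem_compl.mp hj⟩, fun h => hji (congrArg Subtype.val h).symm⟩

/-! #### The state distributed by an honest source -/

/-- In the computational basis, flipping an outcome is the same as flipping the qubit. -/
theorem outcomeVec_flipKey {ι T : Type} [Fintype ι] [DecidableEq ι] [Fintype T]
    (B : ι → Option T → Matrix.unitaryGroup Bit ℂ) (hB : ∀ k, B k none = 1) (i j : ι)
    (out u : ι → Option T → Bit) :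
    outcomeVec B (flipKey i j out) u = outcomeVec B out (flipKey i j u) := by
  simp only [outcomeVec, Fintype.prod_option, Finset.prod_mul_distrib]
  congr 1
  simp only [hB, Matrix.UnitaryGroup.one_val, Matrix.one_apply, Finset.prod_ite_zero,
    Finset.prod_const_one, Finset.mem_univ, true_imp_iff]
  congr 1
  have h1 (a : ι → Option T → Bit) (k : ι) : flipKey i j a k none = a k none + pairFlip i j k :=
    rfl
  have h2 := eq_add_pairFlip_iff i j (fun k => u k none) fun k => out k none
  simp only [funext_iff, Pi.add_apply] at h2
  simp only [h1, h2]

/-- The flip of the qubits of `i` and `j` of the key copy. -/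
def flipQubits (π : P.Allocation) (i j : Honest Z) :
    Equiv.Perm (Honest Z → P.Copy → Bit) :=
  Function.Involutive.toPerm
    (fun u k c => flipKey i j (fun k c => u k (π.symm c)) k (π c)) fun u => by
      simp only [Equiv.apply_symm_apply]
      rw [flipKey_flipKey]
      simp

theorem flipQubits_apply (π : P.Allocation) (i j : Honest Z) (u : Honest Z → P.Copy → Bit) :
    flipQubits π i j u = fun k c => flipKey i j (fun k c => u k (π.symm c)) k (π c) := rfl

theorem honestVec_flipKey (π : P.Allocation) (i j : Honest Z) (out : Honest Z → P.Copy → Bit) :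
    honestVec P π (flipKey i j out) = honestVec P π out ∘ flipQubits π i j := by
  ext u
  simp only [honestVec, Function.comp_apply]
  rw [outcomeVec_perm, outcomeVec_perm (honestBasis P Z) out, flipQubits_apply]
  simp only [Equiv.apply_symm_apply]
  exact outcomeVec_flipKey _ (fun _ => rfl) i j _ _

/-- Only the factor of the key copy is affected, and there the stabilizer X_iX_j acts. -/
theorem ghzCopies_flipQubits (π : P.Allocation) (i j : Honest Z)
    (u : Honest Z → P.Copy → Bit) (e : Colluding Z → P.Copy → Bit) :
    ghzCopies N P.Copy (joinData Z (flipQubits π i j u) e) =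
      ghzCopies N P.Copy (joinData Z u e) := by
  refine Finset.prod_congr rfl fun c _ => ?_
  rw [flipQubits_apply]
  by_cases hc : π c = none
  · rw [← phaseGHZ_add_pairFlip (fun k => joinData Z u e k c) i j]
    congr 1
    ext k
    simp only [joinData, Pi.add_apply]
    split_ifs with hk
    · rw [pairFlip_colluding i j ⟨k, hk⟩, add_zero]
    · rw [pairFlip_coe i j ⟨k, hk⟩]
      beta_reduce
      rw [hc]
      change u ⟨k, hk⟩ (π.symm none) + _ = _
      rw [← hc, Equiv.symm_apply_apply]
  · obtain ⟨τ, hτ⟩ := Option.ne_none_iff_exists'.mp hc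
    congr 1
    ext k
    simp only [joinData]
    split_ifs with hk
    · rfl
    · beta_reduce
      rw [hτ]
      change u ⟨k, hk⟩ (π.symm (some τ)) = _
      rw [← hτ, Equiv.symm_apply_apply]

/-- A symmetry of the state that acts on the first tensor factor alone can be moved off the operator
by reindexing the trace. -/
theorem born_submatrix {α β : Type} [Fintype α] [Fintype β]
    (ρ : Matrix (α × β) (α × β) ℂ) (σ : Equiv.Perm α)
    (hρ : ∀ a b a' b', ρ (σ a, b) (σ a', b') = ρ (a, b) (a', b')) (K : Matrix α α ℂ)
    (F : Matrix β β ℂ) : born ρ (K.submatrix σ σ) F = born ρ K F := by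
  let τ : Equiv.Perm (α × β) := Equiv.prodCongr σ (Equiv.refl β)
  have h1 : ρ.submatrix τ τ = ρ := by
    ext ⟨a, b⟩ ⟨a', b'⟩
    exact hρ a b a' b'
  have h2 : Matrix.kronecker (K.submatrix σ σ) F = (Matrix.kronecker K F).submatrix τ τ := rfl
  rw [born_apply, born_apply, h2]
  conv_lhs => rw [← h1]
  rw [Matrix.submatrix_mul_equiv]
  congr 1
  exact Equiv.sum_comp τ fun p => (ρ * Matrix.kronecker K F) p p

/-- The data of all receivers are those of the honest and of the colluding ones. -/
def joinDataEquiv (Z : Finset (Fin N)) (A : Type) :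
    (Honest Z → A) × (Colluding Z → A) ≃ (Fin N → A) where
  toFun p := joinData Z p.1 p.2
  invFun f := (fun k => f k, fun k => f k)
  left_inv p := by
    refine Prod.ext (funext fun k => ?_) (funext fun k => ?_)
    · simp [joinData, k.2]
    · simp [joinData, k.2]
  right_inv f := by
    ext k
    simp [joinData]

theorem ghzSplit_trace (hN : 1 ≤ N) (Z : Finset (Fin N)) (κ : Type) [Fintype κ]
    [DecidableEq κ] : (ghzSplit Z κ).trace = 1 := by
  rw [← (ghzSource_isDensity (κ := κ) hN).2]
  exact Equiv.sum_comp (joinDataEquiv Z (κ → Bit)) fun a => ghzSource N κ a a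

theorem runProb_ghzSplit_flipRun (A : P.Attack n Z (Colluding Z → P.Copy → Bit) Y)
    (i j : Honest Z) (ω : P.Run n Z Y) :
    runProb (ghzSplit Z P.Copy) A (flipRun i j ω) = runProb (ghzSplit Z P.Copy) A ω := by
  rw [runProb_eq, runProb_eq, runEffect_flipRun, allocation_flipRun, outcomes_flipRun]
  have h : Matrix.vecMulVec (honestVec P ω.2.1 (flipKey i j ω.2.2.1))
      (star (honestVec P ω.2.1 (flipKey i j ω.2.2.1))) =
      (Matrix.vecMulVec (honestVec P ω.2.1 ω.2.2.1)
        (star (honestVec P ω.2.1 ω.2.2.1))).submatrix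
        (flipQubits ω.2.1 i j) (flipQubits ω.2.1 i j) := by
    rw [honestVec_flipKey]
    rfl
  rw [h, born_submatrix]
  intro a b a' b'
  simp only [ghzSplit, ghzSource, Matrix.submatrix_apply, Matrix.vecMulVec_apply, Pi.star_apply,
    ghzCopies_flipQubits]

/-- The tests play no role here: the symmetry needs only GHZ copies and a key copy measured in the
computational basis. -/
theorem unconditionallySecure (P : GHZProtocol N) : P.UnconditionallySecure := by
  intro n Z hZ Y _ A i
  obtain ⟨j, hij⟩ := exists_other_honest hZ i
  have hN : 1 ≤ N := by omega
  have heq (v : P.View n Z Y) : maskViewProb (ghzSplit Z P.Copy) A i 0 v =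
      maskViewProb (ghzSplit Z P.Copy) A i 1 v := by
    rw [maskViewProb_eq, maskViewProb_eq]
    exact jointLaw_eq _ _ _ (flipRun i j) (flipRun_involutive i j) (key_flipRun hij)
      (runView_flipRun i j) (runProb_ghzSplit_flipRun A i j) v
  have hsum : ∑ r, ∑ v, maskViewProb (ghzSplit Z P.Copy) A i r v = 1 := by
    simp only [maskViewProb_eq]
    rw [sum_jointLaw, sum_runProb (ghzSplit_trace hN Z _)]
  rw [sum_bit] at hsum
  simp only [← heq] at hsum
  have h0 : ∑ v, maskViewProb (ghzSplit Z P.Copy) A i 0 v = 1 / 2 := by linarith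
  refine ⟨fun r => ?_, mutualInformation_eq_zero _ heq h0⟩
  rcases bit_eq_zero_or_one r with rfl | rfl
  · exact h0
  · simpa only [← heq] using h0

end GHZProtocol

/-! ### Security against an untrusted source -/

section UntrustedSource

open GHZProtocol

variable {N m n : ℕ} {Z : Finset (Fin N)} {E Y : Type} [Fintype E] [DecidableEq E] [Fintype Y]

/-- The outcomes of `i` and `j` agree for all copies that are tested in the Hadamard basis. -/
def PhaseAgree (i j : Honest Z) (o : Honest Z → (verifiedSum N m).Test → Bit) : Prop :=
  ∀ τ, some τ ∈ phaseRoles N m → o i τ = o j τ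

/-- Relaxes acceptance to an event in honest outcomes alone, so that the coalition's announcements
can be summed out afterwards. -/
theorem phaseAgree_of_passes (i j : Honest Z) (out : Honest Z → (verifiedSum N m).Copy → Bit)
    (c : Colluding Z → (verifiedSum N m).Test → Bit)
    (h : (verifiedSum N m).Passes (announced out c)) :
    PhaseAgree i j fun k τ => out k (some τ) := by
  have h' := ((passes_iff fun k : Fin N => fun r : (verifiedSum N m).Copy =>
    r.elim 0 (announced out c k)).mp h).2
  intro τ hτ
  have := h' (some τ) hτ i j
  simpa [announced, joinData, i.2, j.2] using this

/-- The bases of the honest receivers, except that the key copy is measured in the Hadamard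
basis. -/
def phaseCheckBasis (N m : ℕ) (Z : Finset (Fin N)) (j : Honest Z) (c : (verifiedSum N m).Copy) :
    Matrix.unitaryGroup Bit ℂ :=
  c.elim hadamardBasis fun τ => (verifiedSum N m).roleBasis j (some τ)

/-- A state that passes the validation is nearly invariant under the joint flip of two
qubits of the key copy. -/
theorem phase_error_le
    {ρ : Matrix ((Honest Z → (verifiedSum N m).Copy → Bit) × E)
      ((Honest Z → (verifiedSum N m).Copy → Bit) × E) ℂ} (hρ : IsDensity ρ)
    (hN : 2 ≤ N) (i j : Honest Z) :
    open Classical in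
    ∑ π : (verifiedSum N m).Allocation, 1 / (Fintype.card (verifiedSum N m).Allocation : ℝ) *
      born ρ (∑ out, if PhaseAgree i j (fun k τ => out k (some τ)) then
        Matrix.vecMulVec
          (honestVec (verifiedSum N m) π out - honestVec (verifiedSum N m) π (flipKey i j out))
          (star (honestVec (verifiedSum N m) π out -
            honestVec (verifiedSum N m) π (flipKey i j out))) else 0) 1 ≤
      4 / (m + 1) := by
  classical
  -- The Hadamard measurement of the key copy is hypothetical; it makes that copy exchangeable with
  -- the phase-tested ones.
  have hs := outcomeProj_sampling_bound ((born ρ).flip 1)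
    (fun K hK => born_nonneg hρ.1 hK Matrix.PosSemidef.one)
    (phaseCheckBasis N m Z) none (phaseRoles N m) none_notMem_phaseRoles
    (fun c hc k => by
      obtain ⟨τ, -, rfl⟩ := Finset.mem_map.mp hc
      exact roleBasis_phase (k : Fin N) hc) fun a => a i ≠ a j
  have h1 : (born ρ).flip 1 1 = 1 := by
    rw [LinearMap.flip_apply, born_one_one, hρ.2, Complex.one_re]
  rw [h1] at hs
  have hcond (out : Honest Z → (verifiedSum N m).Copy → Bit) :
      (out i none ≠ out j none ∧ PhaseAgree i j fun k τ => out k (some τ)) ↔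
      (out i none ≠ out j none ∧ ∀ c ∈ phaseRoles N m, ¬ out i c ≠ out j c) := by
    refine and_congr_right fun _ => ⟨fun h c hc => not_not.mpr ?_, fun h τ hτ =>
      not_not.mp (h _ hτ)⟩
    obtain ⟨τ, -, rfl⟩ := Finset.mem_map.mp hc
    exact h τ hc
  have hkey (π : (verifiedSum N m).Allocation) :=
    sum_flipKey_diff_perm (honestBasis (verifiedSum N m) Z) (phaseCheckBasis N m Z)
      (fun _ => rfl) (fun _ => rfl) (fun _ _ => rfl) i j (PhaseAgree i j) π
  have hterm (π : (verifiedSum N m).Allocation) :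
      born ρ (∑ out, if PhaseAgree i j (fun k τ => out k (some τ)) then
        Matrix.vecMulVec
          (honestVec (verifiedSum N m) π out - honestVec (verifiedSum N m) π (flipKey i j out))
          (star (honestVec (verifiedSum N m) π out -
            honestVec (verifiedSum N m) π (flipKey i j out))) else 0) 1 =
      4 * ∑ out : Honest Z → (verifiedSum N m).Copy → Bit,
        if out i none ≠ out j none ∧ ∀ c ∈ phaseRoles N m, ¬ out i c ≠ out j c then
          (born ρ).flip 1 (outcomeProj (fun k c => phaseCheckBasis N m Z k (π c))
            fun k c => out k (π c)) else 0 := by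
    simp only [honestVec]
    rw [hkey π]
    simp only [map_smul, LinearMap.smul_apply, smul_eq_mul, map_sum, LinearMap.sum_apply, hcond]
    congr 1
    refine Finset.sum_congr rfl fun out _ => ?_
    split_ifs
    · rfl
    · simp
  simp only [hterm]
  refine (le_of_eq ?_).trans ((mul_le_mul_of_nonneg_left hs zero_le_four).trans ?_)
  swap
  · rw [mul_one_div]
    gcongr
    exact le_card_phaseRoles hN
  rw [Finset.mul_sum]
  refine Finset.sum_congr rfl fun π _ => ?_
  rw [mul_left_comm, Finset.mul_sum]
  congr 1
  refine Finset.sum_congr rfl fun out _ => ?_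
  rw [mul_ite, mul_zero]
  by_cases h : out i none ≠ out j none ∧ ∀ c ∈ phaseRoles N m, ¬ out i c ≠ out j c
  · exact (if_pos h).trans (if_pos h).symm
  · exact (if_neg h).trans (if_neg h).symm

theorem runEffect_posSemidef (A : (verifiedSum N m).Attack n Z E Y)
    (ω : (verifiedSum N m).Run n Z Y) : (runEffect A ω).PosSemidef :=
  A.effect_posSemidef _ _ _ _ _ _ _

theorem abs_runProb_sub_le {P : GHZProtocol N}
    {ρ : Matrix ((Honest Z → P.Copy → Bit) × E) ((Honest Z → P.Copy → Bit) × E) ℂ}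
    (hρ : IsDensity ρ) (A : P.Attack n Z E Y) (i j : Honest Z) (ω : P.Run n Z Y) {l : ℝ}
    (hl : 0 < l) :
    |runProb ρ A ω - runProb ρ A (flipRun i j ω)| ≤
      1 / (2 ^ (N * n) * (Fintype.card P.Allocation : ℝ)) *
        (l * (born ρ (Matrix.vecMulVec (honestVec P ω.2.1 ω.2.2.1)
            (star (honestVec P ω.2.1 ω.2.2.1))) (runEffect A ω) +
          born ρ (Matrix.vecMulVec (honestVec P ω.2.1 (flipKey i j ω.2.2.1))
            (star (honestVec P ω.2.1 (flipKey i j ω.2.2.1)))) (runEffect A ω)) +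
        l⁻¹ / 2 * born ρ (Matrix.vecMulVec
          (honestVec P ω.2.1 ω.2.2.1 - honestVec P ω.2.1 (flipKey i j ω.2.2.1))
          (star (honestVec P ω.2.1 ω.2.2.1 - honestVec P ω.2.1 (flipKey i j ω.2.2.1))))
          (runEffect A ω)) := by
  rw [runProb_eq, runProb_eq, runEffect_flipRun, allocation_flipRun, outcomes_flipRun,
    ← mul_sub, abs_mul, abs_of_nonneg (by positivity)]
  exact mul_le_mul_of_nonneg_left
    (born_sub_le hρ.1 (A.effect_posSemidef _ _ _ _ _ _ _) _ _ hl) (by positivity)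

open Classical in
-- The two rank-one terms of `born_sub_le` each sum to total probability one, which gives 2l. The
-- difference term is summed over the larger event `PhaseAgree` and contributes at most l⁻¹/2 times
-- 4/(m+1).
theorem sum_abs_runProb_le
    {ρ : Matrix ((Honest Z → (verifiedSum N m).Copy → Bit) × E)
      ((Honest Z → (verifiedSum N m).Copy → Bit) × E) ℂ} (hρ : IsDensity ρ)
    (hN : 2 ≤ N) (A : (verifiedSum N m).Attack n Z E Y) (i j : Honest Z) {l : ℝ} (hl : 0 < l) :
    ∑ ω : (verifiedSum N m).Run n Z Y, (if (verifiedSum N m).Passes (runView ω).2.1 then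
      |runProb ρ A ω - runProb ρ A (flipRun i j ω)| else 0) ≤
      2 * l + 2 * l⁻¹ / (m + 1) := by
  set w : ℝ := 1 / (2 ^ (N * n) * (Fintype.card (verifiedSum N m).Allocation : ℝ)) with hw
  have hw0 : 0 ≤ w := by positivity
  let d (π : (verifiedSum N m).Allocation) (out : Honest Z → (verifiedSum N m).Copy → Bit) :
      Matrix (Honest Z → (verifiedSum N m).Copy → Bit)
        (Honest Z → (verifiedSum N m).Copy → Bit) ℂ :=
    Matrix.vecMulVec
      (honestVec (verifiedSum N m) π out - honestVec (verifiedSum N m) π (flipKey i j out))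
      (star (honestVec (verifiedSum N m) π out -
        honestVec (verifiedSum N m) π (flipKey i j out)))
  let s (π : (verifiedSum N m).Allocation) (out : Honest Z → (verifiedSum N m).Copy → Bit) :
      Matrix (Honest Z → (verifiedSum N m).Copy → Bit)
        (Honest Z → (verifiedSum N m).Copy → Bit) ℂ :=
    Matrix.vecMulVec (honestVec (verifiedSum N m) π out)
      (star (honestVec (verifiedSum N m) π out))
  let g (π : (verifiedSum N m).Allocation) (out : Honest Z → (verifiedSum N m).Copy → Bit) :
      Matrix (Honest Z → (verifiedSum N m).Copy → Bit)
        (Honest Z → (verifiedSum N m).Copy → Bit) ℂ :=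
    if PhaseAgree i j (fun k τ => out k (some τ)) then d π out else 0
  have hpt (ω : (verifiedSum N m).Run n Z Y) :
      (if (verifiedSum N m).Passes (runView ω).2.1 then
        |runProb ρ A ω - runProb ρ A (flipRun i j ω)| else 0) ≤
      l * (w * born ρ (s ω.2.1 ω.2.2.1) (runEffect A ω)) +
      l * (w * born ρ (s ω.2.1 (flipKey i j ω.2.2.1)) (runEffect A ω)) +
      l⁻¹ / 2 * (w * born ρ (g ω.2.1 ω.2.2.1) (runEffect A ω)) := by
    have hF := runEffect_posSemidef A ω
    have h1 : 0 ≤ born ρ (s ω.2.1 ω.2.2.1) (runEffect A ω) :=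
      born_nonneg hρ.1 (Matrix.posSemidef_vecMulVec_self_star _) hF
    have h2 : 0 ≤ born ρ (s ω.2.1 (flipKey i j ω.2.2.1)) (runEffect A ω) :=
      born_nonneg hρ.1 (Matrix.posSemidef_vecMulVec_self_star _) hF
    split_ifs with hp
    · have hg : g ω.2.1 ω.2.2.1 = d ω.2.1 ω.2.2.1 :=
        if_pos (phaseAgree_of_passes i j ω.2.2.1 ω.2.2.2.1 hp)
      refine (abs_runProb_sub_le hρ A i j ω hl).trans (le_of_eq ?_)
      rw [hg, ← hw]
      simp only [s, d]
      ring
    · have h3 : 0 ≤ born ρ (g ω.2.1 ω.2.2.1) (runEffect A ω) := by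
        simp only [g]
        split_ifs
        · exact born_nonneg hρ.1 (Matrix.posSemidef_vecMulVec_self_star _) hF
        · simp
      exact add_nonneg (add_nonneg (mul_nonneg hl.le (mul_nonneg hw0 h1))
        (mul_nonneg hl.le (mul_nonneg hw0 h2)))
        (mul_nonneg (half_pos (inv_pos.mpr hl)).le (mul_nonneg hw0 h3))
  refine (Finset.sum_le_sum fun ω _ => hpt ω).trans ?_
  have e1 := sum_run_born ρ A s
  have e2 := sum_run_born ρ A fun π out => s π (flipKey i j out)
  have e3 := sum_run_born ρ A g
  rw [← hw, ← Finset.mul_sum] at e1 e2 e3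
  simp only [Finset.sum_add_distrib, ← Finset.mul_sum]
  rw [e1, e2, e3]
  have hs1 (π : (verifiedSum N m).Allocation) : ∑ out, s π out = 1 := sum_honestVec π
  have hs2 (π : (verifiedSum N m).Allocation) : ∑ out, s π (flipKey i j out) = 1 :=
    (sum_flipKey i j (s π)).trans (hs1 π)
  have hg := phase_error_le hρ hN i j
  simp only [hs1, hs2, born_one_one, hρ.2, Complex.one_re, sum_avg]
  calc _ ≤ l * 1 + l * 1 + l⁻¹ / 2 * (4 / (m + 1)) := by gcongr
    _ = _ := by ring

/-- Bound on the failure probability of the validation with security parameter `m`. -/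
def validationError (m : ℕ) : ℝ := 2 / Real.sqrt (m + 1)

theorem verifiedSum_verifiesSecurity (hN : 2 ≤ N) :
    (verifiedSum N m).VerifiesSecurity (validationError m) := by
  classical
  intro n Z hZ E Y _ _ _ ρ hρ A i
  obtain ⟨j, hij⟩ := exists_other_honest hZ i
  have hm : (0 : ℝ) < m + 1 := by positivity
  have hsq : Real.sqrt (m + 1) * Real.sqrt (m + 1) = m + 1 := Real.mul_self_sqrt hm.le
  have hs0 : 0 < Real.sqrt (m + 1) := Real.sqrt_pos.mpr hm
  have h1 := sum_abs_jointLaw_le (runProb ρ A) (fun ω => ω.2.2.1 i none) runView (flipRun i j)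
    (flipRun_involutive i j) (key_flipRun hij) (runView_flipRun i j)
    fun v => (verifiedSum N m).Passes v.2.1
  -- The choice l = 1/√(m+1) balances the two terms of the bound.
  have h2 := h1.trans (sum_abs_runProb_le hρ hN A i j (inv_pos.mpr hs0))
  have hv (v : (verifiedSum N m).View n Z Y) :
      ∑ r, |maskViewProb ρ A i r v - 1 / 2 * ∑ r', maskViewProb ρ A i r' v| =
      |jointLaw (runProb ρ A) (fun ω => ω.2.2.1 i none) runView 0 v -
        jointLaw (runProb ρ A) (fun ω => ω.2.2.1 i none) runView 1 v| := by
    simp only [sum_bit, maskViewProb_eq]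
    set a := jointLaw (runProb ρ A) (fun ω => ω.2.2.1 i none) runView 0 v
    set b := jointLaw (runProb ρ A) (fun ω => ω.2.2.1 i none) runView 1 v
    rw [show a - 1 / 2 * (a + b) = (a - b) / 2 by ring,
      show b - 1 / 2 * (a + b) = -((a - b) / 2) by ring, abs_neg, abs_div, abs_two]
    ring
  simp only [hv]
  have h3 : 2 * (Real.sqrt (m + 1))⁻¹ + 2 * (Real.sqrt (m + 1))⁻¹⁻¹ / (m + 1) =
      2 * validationError m := by
    rw [validationError, inv_inv]
    nth_rewrite 3 [← hsq]
    field_simp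
    ring
  rw [h3] at h2
  linarith

end UntrustedSource

/-! ### Costs -/

/-- The N masked messages are missing after an abort, hence two different bounds. -/
theorem length_transcript {N n : ℕ} (P : GHZProtocol N) (π : P.Allocation)
    (ann : Fin N → P.Test → Bit) (s : Fin N → Fin n → Bit) :
    2 * N ≤ (P.transcript π ann s).length ∧ (P.transcript π ann s).length ≤ 1 + 3 * N := by
  unfold GHZProtocol.transcript
  split_ifs <;> simp only [List.length_append, List.length_ofFn, List.length_singleton,
    List.length_nil] <;> omega

theorem verifiedSum_entanglementCost (N m : ℕ) :
    (verifiedSum N m).entanglementCost = N * (2 * (N * m)) + 1 := by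
  simp [GHZProtocol.entanglementCost, verifiedSum]

theorem validationError_tendsto : Tendsto validationError atTop (𝓝 0) := by
  refine Tendsto.div_atTop tendsto_const_nhds ?_
  refine Real.tendsto_sqrt_atTop.comp ?_
  exact tendsto_atTop_add_const_right _ _ tendsto_natCast_atTop_atTop

/-- The parity error is the smaller one, so a single ε serves both verification claims. -/
theorem inv_le_validationError (m : ℕ) : 1 / ((m : ℝ) + 1) ≤ validationError m := by
  have h1 : (1 : ℝ) ≤ m + 1 := by simp
  have h2 : Real.sqrt (m + 1) ≤ m + 1 := Real.sqrt_le_self_iff.mpr (Or.inr h1)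
  have h3 : 0 < Real.sqrt (m + 1) := Real.sqrt_pos.mpr (by linarith)
  rw [validationError]
  exact div_le_div₀ (by norm_num) (by norm_num) h3 h2

end

theorem theorem3 :
    ∃ (P : ∀ N : ℕ, ℕ → GHZProtocol N) (ε : ℕ → ℝ),
      -- classical communication of order `N`
      (∃ a b : ℝ, 0 < a ∧ 0 < b ∧ ∀ N m : ℕ, 2 ≤ N → 1 ≤ m →
        ∀ (n : ℕ) (π : (P N m).Allocation) (ann : Fin N → (P N m).Test → Bit)
          (s : Fin N → Fin n → Bit),
          a * N ≤ (((P N m).transcript π ann s).length : ℝ) ∧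
          (((P N m).transcript π ann s).length : ℝ) ≤ b * N) ∧
      -- entanglement of order `N ^ 2 * m`
      (∃ a b : ℝ, 0 < a ∧ 0 < b ∧ ∀ N m : ℕ, 2 ≤ N → 1 ≤ m →
        a * (N ^ 2 * m) ≤ ((P N m).entanglementCost : ℝ) ∧
        ((P N m).entanglementCost : ℝ) ≤ b * (N ^ 2 * m)) ∧
      -- the error of the validation vanishes with the security parameter
      Filter.Tendsto ε Filter.atTop (nhds 0) ∧
      ∀ N m : ℕ, 2 ≤ N → 1 ≤ m →
        Achievable ((P N m).coordinator (ghzSource N (P N m).Copy)) (fun _ => 1) ∧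
        (P N m).Reliable ∧
        (P N m).UnconditionallySecure ∧
        (P N m).VerifiesSum (ε m) ∧
        (P N m).VerifiesSecurity (ε m) := by
  -- The constants 4 and 3 absorb the additive 1 in 1 + 3N and in 2N²m + 1, as N and N²m are at
  -- least 1.
  refine ⟨verifiedSum, validationError, ⟨1, 4, one_pos, by norm_num, ?_⟩,
    ⟨2, 3, two_pos, by norm_num, ?_⟩, validationError_tendsto, ?_⟩
  · intro N m hN _ n π ann s
    obtain ⟨h1, h2⟩ := length_transcript (verifiedSum N m) π ann s
    refine ⟨?_, ?_⟩
    · have : N ≤ ((verifiedSum N m).transcript π ann s).length := by omega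
      rw [one_mul]
      exact_mod_cast this
    · have : ((verifiedSum N m).transcript π ann s).length ≤ 4 * N := by omega
      exact_mod_cast this
  · intro N m hN hm
    rw [verifiedSum_entanglementCost]
    have h : 1 ≤ N ^ 2 * m := Nat.mul_pos (by positivity) hm
    refine ⟨?_, ?_⟩
    · have : 2 * (N ^ 2 * m) ≤ N * (2 * (N * m)) + 1 := by linarith
      exact_mod_cast this
    · have : N * (2 * (N * m)) + 1 ≤ 3 * (N ^ 2 * m) := by linarith
      exact_mod_cast this
  · intro N m hN _
    have hN' : 1 ≤ N := by omega
    refine ⟨verifiedSum_achievable hN', verifiedSum_reliable hN',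
      GHZProtocol.unconditionallySecure _, ?_, verifiedSum_verifiesSecurity hN⟩
    intro ρ hρ n x
    exact (verifiedSum_verifiesSum hN ρ hρ n x).trans (inv_le_validationError m)
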